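/- Let $A$ be a C*-algebra (not necessarily unital), let $G$ be a discrete group, and let $\alpha : G \to \operatorname{Aut}(A)$ be an action of $G$ on $A$ by $^*$-automorphisms. Suppose that $G$ is amenable, i.e. that there is a left invariant mean on $\ell^\infty(G)$, and that $A$ is commutative or finite-dimensional. Let $\ell^1(G,A;\alpha)$ be the Banach $^*$-algebra of all $f : G \to A$ with $\|f\| = \sum_{g\in G}\|f(g)\| < \infty$, with product $(f f')(g) = \sum_{k\in G} f(k)\,\alpha_k(f'(k^{-1}g))$ and involution $f^*(g) = \alpha_g(f(g^{-1})^*)$, and let the crossed product $A\rtimes_\alpha G$ be its enveloping C*-algebra, i.e. the Hausdorff completion of $\ell^1(G,A;\alpha)$ with respect to the C*-seminorm $f \mapsto \sup_\pi \|\pi(f)\|$, where $\pi$ runs through the $^*$-representations of $\ell^1(G,A;\alpha)$ on Hilbert spaces. Then $A\rtimes_\alpha G$ is an amenable Banach algebra: for every Banach $(A\rtimes_\alpha G)$-bimodule $E$ and every bounded derivation $D : A\rtimes_\alpha G \to E^*$ there is $x^*\in E^*$ such that $D(b) = b\cdot x^* - x^*\cdot b$ for all $b \in A\rtimes_\alpha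 G$. -/

import Mathlib

universe u v w

noncomputable section

open scoped ENNReal

/-! ## Amenability of discrete groups -/

namespace AmenableGroup

variable {G : Type u} [Group G]

/-- The left translate `h ↦ f (g⁻¹ * h)` of a bounded function `f ∈ ℓ^∞(G)`. -/
def leftTranslate (g : G) (f : lp (fun _ : G => ℂ) ∞) : lp (fun _ : G => ℂ) ∞ :=
  ⟨fun h => f (g⁻¹ * h), by
    refine memℓp_infty ⟨‖f‖, ?_⟩
    rintro _ ⟨h, rfl⟩
    exact lp.norm_apply_le_norm ENNReal.top_ne_zero f (g⁻¹ * h)⟩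

end AmenableGroup

/-- A discrete group `G` is amenable if there is a left invariant mean on `ℓ^∞(G)`, i.e. a bounded
linear functional `m` with `‖m‖ = m 1 = 1` that is invariant under left translations. -/
def IsAmenableGroup (G : Type u) [Group G] : Prop :=
  ∃ m : lp (fun _ : G => ℂ) ∞ →L[ℂ] ℂ, ‖m‖ = 1 ∧ m 1 = 1 ∧
    ∀ (g : G) (f : lp (fun _ : G => ℂ) ∞), m (AmenableGroup.leftTranslate g f) = m f

/-! ## Amenability of Banach algebras -/

/-- The structure of a Banach `B`-bimodule on a Banach space `E`: `left b x` is `b · x` and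
`right b x` is `x · b`. That both are bounded linear maps `B → (E → E)` says exactly that the
actions are bilinear with `‖b · x‖ ≤ C ‖b‖ ‖x‖` and `‖x · b‖ ≤ C ‖b‖ ‖x‖` for some `C`. -/
structure BanachBimodule (B : Type u) [NonUnitalNormedRing B] [NormedSpace ℂ B]
    (E : Type w) [NormedAddCommGroup E] [NormedSpace ℂ E] where
  left : B →L[ℂ] E →L[ℂ] E
  right : B →L[ℂ] E →L[ℂ] E
  left_mul : ∀ (a b : B) (x : E), left (a * b) x = left a (left b x)
  right_mul : ∀ (a b : B) (x : E), right (a * b) x = right b (right a x)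
  left_right : ∀ (a b : B) (x : E), right b (left a x) = left a (right b x)

namespace BanachBimodule

variable {B : Type u} [NonUnitalNormedRing B] [NormedSpace ℂ B]
  {E : Type w} [NormedAddCommGroup E] [NormedSpace ℂ E] (M : BanachBimodule B E)

/-- The left action on the dual: `(b · φ)(x) = φ (x · b)`. -/
def dualLeft (b : B) (φ : StrongDual ℂ E) : StrongDual ℂ E := φ.comp (M.right b)

/-- The right action on the dual: `(φ · b)(x) = φ (b · x)`. -/
def dualRight (φ : StrongDual ℂ E) (b : B) : StrongDual ℂ E := φ.comp (M.left b)

/-- `D : B → E*` is a derivation. -/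
def IsDerivation (D : B →L[ℂ] StrongDual ℂ E) : Prop :=
  ∀ a b : B, D (a * b) = M.dualLeft a (D b) + M.dualRight (D a) b

/-- `D : B → E*` is inner. -/
def IsInner (D : B →L[ℂ] StrongDual ℂ E) : Prop :=
  ∃ φ : StrongDual ℂ E, ∀ b : B, D b = M.dualLeft b φ - M.dualRight φ b

end BanachBimodule

/-- A Banach algebra `B` is amenable if every bounded derivation from `B` into the dual of any
Banach `B`-bimodule `E` (in the universe `w`) is inner. -/
def IsAmenableBanachAlgebra (B : Type u) [NonUnitalNormedRing B] [NormedSpace ℂ B] : Prop :=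
  ∀ (E : Type w) [NormedAddCommGroup E] [NormedSpace ℂ E] [CompleteSpace E]
    (M : BanachBimodule B E) (D : B →L[ℂ] StrongDual ℂ E), M.IsDerivation D → M.IsInner D

/-! ## The Banach `*`-algebra `ℓ¹(G, A; α)` -/

section L1

variable {G : Type u} [Group G] {A : Type v} [NonUnitalCStarAlgebra A]

/-- The space of all `f : G → A` with `‖f‖ = ∑ g, ‖f g‖ < ∞`. It is a type synonym, since it will
carry the twisted product and involution determined by `α`. -/
@[nolint unusedArguments]
def L1Algebra (_ : G →* (A ≃⋆ₐ[ℂ] A)) : Type (max u v) := lp (fun _ : G => A) 1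

namespace L1Algebra

variable (α : G →* (A ≃⋆ₐ[ℂ] A))

instance : NormedAddCommGroup (L1Algebra α) :=
  inferInstanceAs (NormedAddCommGroup (lp (fun _ : G => A) 1))

instance : NormedSpace ℂ (L1Algebra α) :=
  inferInstanceAs (NormedSpace ℂ (lp (fun _ : G => A) 1))

instance : CompleteSpace (L1Algebra α) :=
  inferInstanceAs (CompleteSpace (lp (fun _ : G => A) 1))

variable {α}

/-- The underlying function `G → A`. -/
def coeff (f : L1Algebra α) : G → A := f.1

theorem ext {f g : L1Algebra α} (h : ∀ x, f.coeff x = g.coeff x) : f = g :=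
  Subtype.ext (funext h)

theorem coeff_add (f g : L1Algebra α) (x : G) : (f + g).coeff x = f.coeff x + g.coeff x := rfl

theorem coeff_smul (c : ℂ) (f : L1Algebra α) (x : G) : (c • f).coeff x = c • f.coeff x := rfl

theorem coeff_memlp (f : L1Algebra α) : Memℓp f.coeff 1 := f.2

theorem summable_norm (f : L1Algebra α) : Summable fun x => ‖f.coeff x‖ := by
  simpa using f.coeff_memlp.summable (by simp)

theorem norm_def (f : L1Algebra α) : ‖f‖ = ∑' x, ‖f.coeff x‖ := by
  have h := lp.norm_eq_tsum_rpow (E := fun _ : G => A) (p := 1) (by simp)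
    (show lp (fun _ : G => A) 1 from f)
  simp only [ENNReal.toReal_one, Real.rpow_one, div_one] at h
  exact h

set_option linter.unusedSectionVars false in
theorem memlp_of_summable {f : G → A} (h : Summable fun x => ‖f x‖) : Memℓp f 1 :=
  memℓp_gen (by simpa using h)

theorem norm_act (g : G) (a : A) : ‖α g a‖ = ‖a‖ := StarAlgEquiv.norm_map (α g) a

theorem act_act (g h : G) (a : A) : α g (α h a) = α (g * h) a := by
  rw [map_mul, StarAlgEquiv.mul_apply]

theorem hasSum_aux (f g : L1Algebra α) :
    HasSum (fun p : G × G => ‖f.coeff p.2‖ * ‖g.coeff (p.2⁻¹ * p.1)‖) (‖f‖ * ‖g‖) := by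
  have h1 : HasSum (fun p : G × G => ‖f.coeff p.1‖ * ‖g.coeff p.2‖) (‖f‖ * ‖g‖) := by
    have hs : Summable fun p : G × G => ‖f.coeff p.1‖ * ‖g.coeff p.2‖ :=
      Summable.mul_of_nonneg (f := fun x => ‖f.coeff x‖) (g := fun x => ‖g.coeff x‖)
        f.summable_norm g.summable_norm (fun _ => norm_nonneg _) (fun _ => norm_nonneg _)
    rw [norm_def, norm_def]
    exact HasSum.mul (f := fun x => ‖f.coeff x‖) (g := fun x => ‖g.coeff x‖)
      f.summable_norm.hasSum g.summable_norm.hasSum hs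
  let e : G × G ≃ G × G :=
    { toFun := fun p => (p.2, p.2⁻¹ * p.1)
      invFun := fun p => (p.1 * p.2, p.1)
      left_inv := fun p => by simp
      right_inv := fun p => by simp }
  exact (e.hasSum_iff (f := fun p : G × G => ‖f.coeff p.1‖ * ‖g.coeff p.2‖)).2 h1

theorem norm_mul_term (f g : L1Algebra α) (x k : G) :
    ‖f.coeff k * α k (g.coeff (k⁻¹ * x))‖ ≤ ‖f.coeff k‖ * ‖g.coeff (k⁻¹ * x)‖ :=
  (norm_mul_le _ _).trans_eq (by rw [norm_act])

theorem summable_mul_term_norm (f g : L1Algebra α) (x : G) :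
    Summable fun k => ‖f.coeff k * α k (g.coeff (k⁻¹ * x))‖ :=
  Summable.of_nonneg_of_le (fun _ => norm_nonneg _) (norm_mul_term f g x)
    ((hasSum_aux f g).summable.prod_factor x)

theorem norm_mul_coeff_le (f g : L1Algebra α) (x : G) :
    ‖∑' k, f.coeff k * α k (g.coeff (k⁻¹ * x))‖ ≤
      ∑' k, ‖f.coeff k‖ * ‖g.coeff (k⁻¹ * x)‖ :=
  (norm_tsum_le_tsum_norm (summable_mul_term_norm f g x)).trans
    ((summable_mul_term_norm f g x).tsum_le_tsum (norm_mul_term f g x)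
      ((hasSum_aux f g).summable.prod_factor x))

theorem summable_mul_coeff (f g : L1Algebra α) :
    Summable fun x => ‖∑' k, f.coeff k * α k (g.coeff (k⁻¹ * x))‖ :=
  Summable.of_nonneg_of_le (fun _ => norm_nonneg _) (norm_mul_coeff_le f g)
    (hasSum_aux f g).summable.prod

/-- The twisted convolution product `(f g)(x) = ∑ k, f(k) α_k(g(k⁻¹ x))`. -/
instance : Mul (L1Algebra α) :=
  ⟨fun f g => ⟨fun x => ∑' k, f.coeff k * α k (g.coeff (k⁻¹ * x)),
    memlp_of_summable (summable_mul_coeff f g)⟩⟩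

theorem coeff_mul (f g : L1Algebra α) (x : G) :
    (f * g).coeff x = ∑' k, f.coeff k * α k (g.coeff (k⁻¹ * x)) := rfl

theorem norm_mul_le' (f g : L1Algebra α) : ‖f * g‖ ≤ ‖f‖ * ‖g‖ := by
  rw [← (hasSum_aux f g).tsum_eq, (hasSum_aux f g).summable.tsum_prod, norm_def]
  exact (summable_mul_coeff f g).tsum_le_tsum (norm_mul_coeff_le f g)
    (hasSum_aux f g).summable.prod

theorem add_mul' (f g h : L1Algebra α) : (f + g) * h = f * h + g * h := by
  refine ext fun x => ?_
  rw [coeff_add, coeff_mul, coeff_mul, coeff_mul,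
    ← (summable_mul_term_norm f h x).of_norm.tsum_add (summable_mul_term_norm g h x).of_norm]
  simp only [coeff_add, add_mul]

theorem mul_add' (f g h : L1Algebra α) : f * (g + h) = f * g + f * h := by
  refine ext fun x => ?_
  rw [coeff_add, coeff_mul, coeff_mul, coeff_mul,
    ← (summable_mul_term_norm f g x).of_norm.tsum_add (summable_mul_term_norm f h x).of_norm]
  simp only [coeff_add, map_add, mul_add]

theorem smul_mul' (c : ℂ) (f g : L1Algebra α) : (c • f) * g = c • (f * g) := by
  refine ext fun x => ?_
  rw [coeff_smul, coeff_mul, coeff_mul, ← (summable_mul_term_norm f g x).of_norm.tsum_const_smul]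
  simp only [coeff_smul, smul_mul_assoc]

theorem mul_smul' (c : ℂ) (f g : L1Algebra α) : f * (c • g) = c • (f * g) := by
  refine ext fun x => ?_
  rw [coeff_smul, coeff_mul, coeff_mul, ← (summable_mul_term_norm f g x).of_norm.tsum_const_smul]
  simp only [coeff_smul, map_smul, mul_smul_comm]

/-- The product as a bounded bilinear map. -/
def mulL : L1Algebra α →L[ℂ] L1Algebra α →L[ℂ] L1Algebra α :=
  LinearMap.mkContinuous₂
    (LinearMap.mk₂ ℂ (fun f g : L1Algebra α => f * g) add_mul' smul_mul' mul_add' mul_smul') 1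
    (fun f g => (norm_mul_le' f g).trans_eq (by rw [one_mul]))

theorem mulL_apply (f g : L1Algebra α) : mulL f g = f * g := rfl

open scoped Classical in
/-- The function with value `a` at `g` and `0` elsewhere. -/
def single (α : G →* (A ≃⋆ₐ[ℂ] A)) (g : G) (a : A) : L1Algebra α :=
  lp.single (E := fun _ : G => A) 1 g a

theorem coeff_single_self (g : G) (a : A) : (single α g a).coeff g = a := by
  classical
  exact lp.single_apply_self (E := fun _ : G => A) 1 g a

theorem coeff_single_ne {g x : G} (a : A) (h : x ≠ g) : (single α g a).coeff x = 0 := by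
  classical
  exact lp.single_apply_ne (E := fun _ : G => A) 1 g a h

theorem single_mul_single (g h : G) (a b : A) :
    single α g a * single α h b = single α (g * h) (a * α g b) := by
  refine ext fun x => ?_
  rw [coeff_mul, tsum_eq_single g]
  · rw [coeff_single_self]
    by_cases hx : x = g * h
    · subst hx
      rw [inv_mul_cancel_left, coeff_single_self, coeff_single_self]
    · rw [coeff_single_ne _ hx, coeff_single_ne, map_zero, mul_zero]
      rintro rfl
      exact hx (by simp)
  · intro k hk
    rw [coeff_single_ne _ hk, zero_mul]

theorem induction_on {P : L1Algebra α → Prop} (f : L1Algebra α) (hc : IsClosed {f | P f})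
    (h0 : P 0) (ha : ∀ f g, P f → P g → P (f + g)) (hs : ∀ g a, P (single α g a)) : P f := by
  classical
  have key : HasSum (fun g => single α g (f.coeff g)) f :=
    lp.hasSum_single (E := fun _ : G => A) (p := 1) ENNReal.one_ne_top
      (show lp (fun _ : G => A) 1 from f)
  refine hc.mem_of_tendsto key (Filter.Eventually.of_forall fun s => ?_)
  change P _
  induction s using Finset.induction_on with
  | empty => simpa using h0
  | insert x s hx ih =>
    rw [Finset.sum_insert hx]
    exact ha _ _ (hs _ _) ih

theorem mul_assoc' (f g h : L1Algebra α) : f * g * h = f * (g * h) := by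
  change mulL (mulL f g) h = mulL f (mulL g h)
  induction f using induction_on with
  | hc => exact isClosed_eq (by fun_prop) (by fun_prop)
  | h0 => simp
  | ha f f' h1 h2 => simp only [map_add, add_apply, h1, h2]
  | hs x a =>
    induction g using induction_on with
    | hc => exact isClosed_eq (by fun_prop) (by fun_prop)
    | h0 => simp
    | ha f f' h1 h2 => simp only [map_add, add_apply, h1, h2]
    | hs y b =>
      induction h using induction_on with
      | hc => exact isClosed_eq (by fun_prop) (by fun_prop)
      | h0 => simp
      | ha f f' h1 h2 => simp only [map_add, h1, h2]
      | hs z c =>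
        simp only [mulL_apply, single_mul_single, map_mul (α x), act_act, mul_assoc]

instance : NonUnitalNormedRing (L1Algebra α) :=
  { (inferInstance : NormedAddCommGroup (L1Algebra α)), (inferInstance : Mul (L1Algebra α)) with
    left_distrib := mul_add'
    right_distrib := add_mul'
    zero_mul := fun f => by
      have := smul_mul' (0 : ℂ) f f
      simpa using this
    mul_zero := fun f => by
      have := mul_smul' (0 : ℂ) f f
      simpa using this
    mul_assoc := mul_assoc'
    norm_mul_le := norm_mul_le' }

instance : IsScalarTower ℂ (L1Algebra α) (L1Algebra α) := ⟨smul_mul'⟩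

instance : SMulCommClass ℂ (L1Algebra α) (L1Algebra α) := ⟨fun c f g => (mul_smul' c f g).symm⟩

theorem norm_star_coeff (f : L1Algebra α) (g : G) :
    ‖α g (star (f.coeff g⁻¹))‖ = ‖f.coeff g⁻¹‖ := by
  rw [norm_act, norm_star]

theorem summable_star (f : L1Algebra α) : Summable fun g => ‖α g (star (f.coeff g⁻¹))‖ := by
  have h : Summable fun g : G => ‖f.coeff g⁻¹‖ :=
    (Equiv.inv G).summable_iff (f := fun g => ‖f.coeff g‖) |>.2 f.summable_norm
  exact h.congr fun g => (norm_star_coeff f g).symm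

/-- The twisted involution `f*(g) = α_g(f(g⁻¹)*)`. -/
instance : Star (L1Algebra α) :=
  ⟨fun f => ⟨fun g => α g (star (f.coeff g⁻¹)), memlp_of_summable (summable_star f)⟩⟩

theorem coeff_star (f : L1Algebra α) (g : G) : (star f).coeff g = α g (star (f.coeff g⁻¹)) := rfl

theorem norm_star' (f : L1Algebra α) : ‖star f‖ = ‖f‖ := by
  simp only [norm_def, coeff_star, norm_star_coeff]
  exact (Equiv.inv G).tsum_eq fun g => ‖f.coeff g‖

theorem star_add' (f g : L1Algebra α) : star (f + g) = star f + star g :=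
  ext fun x => by simp only [coeff_star, coeff_add, star_add, map_add]

theorem star_smul' (c : ℂ) (f : L1Algebra α) : star (c • f) = star c • star f :=
  ext fun x => by simp only [coeff_star, coeff_smul, star_smul, map_smul]

theorem continuous_star' : Continuous (star : L1Algebra α → L1Algebra α) :=
  AddMonoidHomClass.continuous_of_bound (AddMonoidHom.mk' (star : L1Algebra α → _) star_add') 1
    (fun f => by simpa using (norm_star' f).le)

theorem star_single (g : G) (a : A) : star (single α g a) = single α g⁻¹ (α g⁻¹ (star a)) := by
  refine ext fun x => ?_
  rw [coeff_star]
  by_cases hx : x = g⁻¹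
  · subst hx
    rw [inv_inv, coeff_single_self, coeff_single_self]
  · rw [coeff_single_ne _ hx, coeff_single_ne, star_zero, map_zero]
    rintro rfl
    exact hx (by simp)

theorem star_mul' (f g : L1Algebra α) : star (f * g) = star g * star f := by
  have hc := continuous_star' (α := α)
  induction f using induction_on with
  | hc => exact isClosed_eq (hc.comp (continuous_mul_const _)) ((continuous_const_mul _).comp hc)
  | h0 =>
    have : star (0 : L1Algebra α) = 0 := by simpa using star_smul' (0 : ℂ) (0 : L1Algebra α)
    simp [this]
  | ha f f' h1 h2 => simp only [add_mul, mul_add, star_add', h1, h2]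
  | hs x a =>
    induction g using induction_on with
    | hc => exact isClosed_eq (hc.comp (continuous_const_mul _)) ((continuous_mul_const _).comp hc)
    | h0 =>
      have : star (0 : L1Algebra α) = 0 := by simpa using star_smul' (0 : ℂ) (0 : L1Algebra α)
      simp [this]
    | ha f f' h1 h2 => simp only [add_mul, mul_add, star_add', h1, h2]
    | hs y b =>
      simp only [single_mul_single, star_single, star_mul, mul_inv_rev, ← map_star (α x),
        map_mul (α (y⁻¹ * x⁻¹)), act_act, inv_mul_cancel_right]

instance : StarRing (L1Algebra α) where
  star_involutive f := ext fun x => by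
    rw [coeff_star, coeff_star, inv_inv, ← map_star (α x⁻¹), star_star, act_act, mul_inv_cancel,
      map_one, StarAlgEquiv.one_apply]
  star_mul := star_mul'
  star_add := star_add'

instance : StarModule ℂ (L1Algebra α) := ⟨star_smul'⟩

instance : NormedStarGroup (L1Algebra α) := ⟨fun f => (norm_star' f).le⟩

end L1Algebra

end L1

/-! ## The enveloping C*-algebra of a Banach `*`-algebra -/

section Envelope

variable (B : Type u) [NonUnitalNormedRing B] [StarRing B] [NormedSpace ℂ B]

/-- The values `‖π b‖`, where `π` runs through all `*`-representations of `B` on Hilbert spaces.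
Every cyclic representation of `B` lives, up to unitary equivalence, on a Hilbert space in the
universe of `B`, so this universe suffices. -/
def envelopeNormSet (b : B) : Set ℝ :=
  {r | ∃ (H : Type u) (_ : NormedAddCommGroup H) (_ : InnerProductSpace ℂ H)
    (_ : CompleteSpace H) (π : B →⋆ₙₐ[ℂ] (H →L[ℂ] H)), r = ‖π b‖}

/-- The underlying space of `B`, to be equipped with the largest C*-seminorm
`b ↦ sup ‖π b‖`. -/
def PreEnvelope : Type u := B

namespace PreEnvelope

variable {B}

section bound

variable [IsScalarTower ℂ B B] [SMulCommClass ℂ B B] [NormedStarGroup B] [CompleteSpace B]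

set_option linter.unusedSectionVars false in
theorem norm_le_of_mem_quasispectrum {b : B} {z : ℂ} (hz : z ∈ quasispectrum ℂ b) :
    ‖z‖ ≤ ‖b‖ := by
  rw [Unitization.quasispectrum_eq_spectrum_inr' ℂ ℂ,
    ← AlgEquiv.spectrum_eq (WithLp.unitizationAlgEquiv ℂ).symm (b : Unitization ℂ B)] at hz
  have h1 : ‖(1 : WithLp 1 (Unitization ℂ B))‖ = 1 := by
    rw [WithLp.unitization_norm_def]
    change ‖(1 : Unitization ℂ B).fst‖ + ‖(1 : Unitization ℂ B).snd‖ = 1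
    simp
  have : NormOneClass (WithLp 1 (Unitization ℂ B)) := ⟨h1⟩
  refine (spectrum.norm_le_norm_of_mem hz).trans_eq ?_
  exact WithLp.unitization_norm_inr b

/-- Every `*`-representation of a Banach `*`-algebra on a Hilbert space is contractive. -/
theorem norm_rep_le {H : Type w} [NormedAddCommGroup H] [InnerProductSpace ℂ H] [CompleteSpace H]
    (π : B →⋆ₙₐ[ℂ] (H →L[ℂ] H)) (b : B) : ‖π b‖ ≤ ‖b‖ := by
  have key : ∀ s : B, IsSelfAdjoint s → ‖π s‖ ≤ ‖s‖ := by
    intro s hs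
    have h1 : spectralRadius ℂ (π s) ≤ (‖s‖₊ : ℝ≥0∞) := by
      refine iSup₂_le fun z hz => ?_
      have := norm_le_of_mem_quasispectrum
        (NonUnitalAlgHom.quasispectrum_apply_subset π s (spectrum_subset_quasispectrum ℂ _ hz))
      exact_mod_cast this
    rw [(hs.map π).spectralRadius_eq_nnnorm] at h1
    exact_mod_cast h1
  refine le_of_sq_le_sq ?_ (norm_nonneg b)
  calc ‖π b‖ ^ 2 = ‖π (star b * b)‖ := by
        rw [map_mul, map_star, CStarRing.norm_star_mul_self, sq]
    _ ≤ ‖star b * b‖ := key _ (IsSelfAdjoint.star_mul_self b)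
    _ ≤ ‖b‖ ^ 2 := by
        rw [sq]
        exact (norm_mul_le _ _).trans_eq (by rw [norm_star])

theorem bddAbove (b : B) : BddAbove (envelopeNormSet B b) := by
  refine ⟨‖b‖, ?_⟩
  rintro _ ⟨H, _, _, _, π, rfl⟩
  exact norm_rep_le π b

end bound

theorem nonempty (b : B) : (envelopeNormSet B b).Nonempty :=
  ⟨_, PUnit, inferInstance, inferInstance, inferInstance, 0, rfl⟩

instance : Norm (PreEnvelope B) := ⟨fun b => sSup (envelopeNormSet B b)⟩

instance : NonUnitalRing (PreEnvelope B) := NonUnitalNormedRing.toNonUnitalRing (α := B)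

instance : Module ℂ (PreEnvelope B) := NormedSpace.toModule (𝕜 := ℂ) (E := B)

instance : StarRing (PreEnvelope B) := inferInstanceAs (StarRing B)

instance [StarModule ℂ B] : StarModule ℂ (PreEnvelope B) := inferInstanceAs (StarModule ℂ B)

instance [IsScalarTower ℂ B B] : IsScalarTower ℂ (PreEnvelope B) (PreEnvelope B) :=
  inferInstanceAs (IsScalarTower ℂ B B)

instance [SMulCommClass ℂ B B] : SMulCommClass ℂ (PreEnvelope B) (PreEnvelope B) :=
  inferInstanceAs (SMulCommClass ℂ B B)

theorem norm_le_of_forall {b : PreEnvelope B} {r : ℝ}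
    (h : ∀ (H : Type u) [NormedAddCommGroup H] [InnerProductSpace ℂ H] [CompleteSpace H]
      (π : PreEnvelope B →⋆ₙₐ[ℂ] (H →L[ℂ] H)), ‖π b‖ ≤ r) : ‖b‖ ≤ r := by
  refine csSup_le (nonempty (B := B) b) ?_
  rintro _ ⟨H, _, _, _, π, rfl⟩
  exact h H π

variable [IsScalarTower ℂ B B] [SMulCommClass ℂ B B] [NormedStarGroup B] [CompleteSpace B]

theorem le_norm {H : Type u} [NormedAddCommGroup H] [InnerProductSpace ℂ H] [CompleteSpace H]
    (π : PreEnvelope B →⋆ₙₐ[ℂ] (H →L[ℂ] H)) (b : PreEnvelope B) : ‖π b‖ ≤ ‖b‖ :=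
  le_csSup (bddAbove (B := B) b) ⟨H, _, _, _, π, rfl⟩

theorem norm_nonneg' (b : PreEnvelope B) : 0 ≤ ‖b‖ :=
  (norm_nonneg _).trans (le_norm (0 : PreEnvelope B →⋆ₙₐ[ℂ] (PUnit.{u + 1} →L[ℂ] PUnit.{u + 1})) b)

instance : NonUnitalSeminormedRing (PreEnvelope B) :=
  { AddGroupSeminorm.toSeminormedAddCommGroup (E := PreEnvelope B)
      { toFun := fun b => ‖b‖
        map_zero' := le_antisymm (norm_le_of_forall fun H _ _ _ π => by simp) (norm_nonneg' _)
        add_le' := fun a b => norm_le_of_forall fun H _ _ _ π => by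
          rw [map_add]
          exact (norm_add_le _ _).trans (add_le_add (le_norm π a) (le_norm π b))
        neg' := fun a => le_antisymm
          (norm_le_of_forall fun H _ _ _ π => by rw [map_neg, norm_neg]; exact le_norm π a)
          (norm_le_of_forall fun H _ _ _ π => by
            rw [← norm_neg, ← map_neg]; exact le_norm π (-a)) },
    (inferInstance : NonUnitalRing (PreEnvelope B)) with
    norm_mul_le := fun a b => norm_le_of_forall fun H _ _ _ π => by
      rw [map_mul]
      exact (norm_mul_le _ _).trans
        (mul_le_mul (le_norm π a) (le_norm π b) (norm_nonneg _) (norm_nonneg' a)) }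

instance : NormedSpace ℂ (PreEnvelope B) where
  norm_smul_le c b := norm_le_of_forall fun H _ _ _ π => by
    rw [map_smul, norm_smul]
    exact mul_le_mul_of_nonneg_left (le_norm π b) (norm_nonneg c)

instance : NormedStarGroup (PreEnvelope B) where
  norm_star_le b := norm_le_of_forall fun H _ _ _ π => by
    rw [map_star, norm_star]
    exact le_norm π b

theorem norm_mul_self_le (b : PreEnvelope B) : ‖b‖ * ‖b‖ ≤ ‖star b * b‖ := by
  have h : ‖b‖ ≤ Real.sqrt ‖star b * b‖ := norm_le_of_forall fun H _ _ _ π => by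
    refine Real.le_sqrt_of_sq_le ?_
    rw [sq, ← CStarRing.norm_star_mul_self, ← map_star, ← map_mul]
    exact le_norm π _
  calc ‖b‖ * ‖b‖ ≤ Real.sqrt ‖star b * b‖ * Real.sqrt ‖star b * b‖ :=
        mul_self_le_mul_self (norm_nonneg _) h
    _ = ‖star b * b‖ := Real.mul_self_sqrt (norm_nonneg _)

end PreEnvelope

variable [IsScalarTower ℂ B B] [SMulCommClass ℂ B B] [NormedStarGroup B] [CompleteSpace B]

/-- The enveloping C*-algebra of `B`: the Hausdorff completion of `B` with respect to the seminorm
`b ↦ sup ‖π b‖`, where `π` runs through the `*`-representations of `B` on Hilbert spaces. -/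
def CStarEnvelope : Type u := UniformSpace.Completion (PreEnvelope B)

namespace CStarEnvelope

open UniformSpace

instance : NormedAddCommGroup (CStarEnvelope B) :=
  inferInstanceAs (NormedAddCommGroup (Completion (PreEnvelope B)))

instance : NormedSpace ℂ (CStarEnvelope B) :=
  inferInstanceAs (NormedSpace ℂ (Completion (PreEnvelope B)))

instance : CompleteSpace (CStarEnvelope B) :=
  inferInstanceAs (CompleteSpace (Completion (PreEnvelope B)))

variable {B}

/-- The canonical map from `B` to its enveloping C*-algebra. -/
def of : PreEnvelope B →L[ℂ] CStarEnvelope B := Completion.toComplL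

theorem isDenseInducing_of : IsDenseInducing (of : PreEnvelope B → CStarEnvelope B) :=
  Completion.isDenseInducing_coe

theorem isUniformInducing_of : IsUniformInducing (of : PreEnvelope B → CStarEnvelope B) :=
  Completion.isUniformInducing_coe _

theorem norm_of (b : PreEnvelope B) : ‖(of b : CStarEnvelope B)‖ = ‖b‖ := Completion.norm_coe b

/-- The continuous extension of the product of `B`. -/
@[irreducible] def mul (x y : CStarEnvelope B) : CStarEnvelope B :=
  (isDenseInducing_of.prodMap isDenseInducing_of).extend
    (fun p : PreEnvelope B × PreEnvelope B => of (p.1 * p.2)) (x, y)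

instance : Mul (CStarEnvelope B) := ⟨mul⟩

theorem of_mul (a b : PreEnvelope B) : (of (a * b) : CStarEnvelope B) = of a * of b := by
  change _ = mul (of a) (of b)
  rw [mul]
  exact ((isDenseInducing_of.prodMap isDenseInducing_of).extend_eq
    (of.continuous.comp continuous_mul) (a, b)).symm

instance : ContinuousMul (CStarEnvelope B) where
  continuous_mul := by
    change Continuous fun p : CStarEnvelope B × CStarEnvelope B => mul p.1 p.2
    simp only [mul]
    let m : PreEnvelope B →+ PreEnvelope B →+ CStarEnvelope B :=
      AddMonoidHom.mul.compr₂ (of : PreEnvelope B →L[ℂ] CStarEnvelope B).toLinearMap.toAddMonoidHom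
    have : Continuous fun p : PreEnvelope B × PreEnvelope B => m p.1 p.2 :=
      of.continuous.comp continuous_mul
    have di : IsDenseInducing
        ((of : PreEnvelope B →L[ℂ] CStarEnvelope B).toLinearMap.toAddMonoidHom :
          PreEnvelope B → CStarEnvelope B) := isDenseInducing_of
    exact (di.extend_Z_bilin di this :)

/-- The continuous extension of the involution of `B`. -/
@[irreducible] def conj (x : CStarEnvelope B) : CStarEnvelope B :=
  isDenseInducing_of.extend (fun b : PreEnvelope B => of (star b)) x

instance : Star (CStarEnvelope B) := ⟨conj⟩

theorem of_star (b : PreEnvelope B) : (of (star b) : CStarEnvelope B) = star (of b) := by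
  change _ = conj (of b)
  rw [conj]
  exact (isDenseInducing_of.extend_eq (of.continuous.comp continuous_star) b).symm

theorem continuous_star' : Continuous (star : CStarEnvelope B → CStarEnvelope B) := by
  change Continuous fun x : CStarEnvelope B => conj x
  simp only [conj]
  exact (uniformContinuous_uniformly_extend isUniformInducing_of isDenseInducing_of.dense
    (f := fun b : PreEnvelope B => of (star b)) (by
      refine of.uniformContinuous.comp ?_
      exact (starNormedAddGroupHom (E := PreEnvelope B)).uniformContinuous)).continuous

instance : ContinuousStar (CStarEnvelope B) := ⟨continuous_star'⟩

theorem induction_on {P : CStarEnvelope B → Prop} (x : CStarEnvelope B) (hc : IsClosed {x | P x})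
    (h : ∀ b, P (of b)) : P x :=
  isClosed_property isDenseInducing_of.dense hc h x

theorem mul_add' (x y z : CStarEnvelope B) : x * (y + z) = x * y + x * z := by
  induction x using induction_on with
  | hc => exact isClosed_eq (by fun_prop) (by fun_prop)
  | h a =>
    induction y using induction_on with
    | hc => exact isClosed_eq (by fun_prop) (by fun_prop)
    | h b =>
      induction z using induction_on with
      | hc => exact isClosed_eq (by fun_prop) (by fun_prop)
      | h c => simp only [← of_mul, ← map_add, mul_add]

theorem add_mul' (x y z : CStarEnvelope B) : (x + y) * z = x * z + y * z := by
  induction x using induction_on with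
  | hc => exact isClosed_eq (by fun_prop) (by fun_prop)
  | h a =>
    induction y using induction_on with
    | hc => exact isClosed_eq (by fun_prop) (by fun_prop)
    | h b =>
      induction z using induction_on with
      | hc => exact isClosed_eq (by fun_prop) (by fun_prop)
      | h c => simp only [← of_mul, ← map_add, add_mul]

theorem zero_mul' (x : CStarEnvelope B) : 0 * x = 0 := by
  induction x using induction_on with
  | hc => exact isClosed_eq (by fun_prop) (by fun_prop)
  | h a => rw [← map_zero of, ← of_mul, zero_mul]

theorem mul_zero' (x : CStarEnvelope B) : x * 0 = 0 := by
  induction x using induction_on with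
  | hc => exact isClosed_eq (by fun_prop) (by fun_prop)
  | h a => rw [← map_zero of, ← of_mul, mul_zero]

theorem mul_assoc' (x y z : CStarEnvelope B) : x * y * z = x * (y * z) := by
  induction x using induction_on with
  | hc => exact isClosed_eq (by fun_prop) (by fun_prop)
  | h a =>
    induction y using induction_on with
    | hc => exact isClosed_eq (by fun_prop) (by fun_prop)
    | h b =>
      induction z using induction_on with
      | hc => exact isClosed_eq (by fun_prop) (by fun_prop)
      | h c => simp only [← of_mul, mul_assoc]

theorem norm_mul_le' (x y : CStarEnvelope B) : ‖x * y‖ ≤ ‖x‖ * ‖y‖ := by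
  induction x using induction_on with
  | hc => exact isClosed_le (by fun_prop) (by fun_prop)
  | h a =>
    induction y using induction_on with
    | hc => exact isClosed_le (by fun_prop) (by fun_prop)
    | h b => simpa only [← of_mul, norm_of] using norm_mul_le a b

theorem smul_mul' (c : ℂ) (x y : CStarEnvelope B) : (c • x) * y = c • (x * y) := by
  induction x using induction_on with
  | hc => exact isClosed_eq ((continuous_mul_const _).comp (continuous_const_smul c)) ((continuous_const_smul c).comp (continuous_mul_const _))
  | h a =>
    induction y using induction_on with
    | hc => exact isClosed_eq (continuous_const_mul _) ((continuous_const_smul c).comp (continuous_const_mul _))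
    | h b => simp only [← map_smul, ← of_mul, smul_mul_assoc]

theorem mul_smul' (c : ℂ) (x y : CStarEnvelope B) : c • (x * y) = x * (c • y) := by
  induction x using induction_on with
  | hc => exact isClosed_eq ((continuous_const_smul c).comp (continuous_mul_const _)) (continuous_mul_const _)
  | h a =>
    induction y using induction_on with
    | hc => exact isClosed_eq ((continuous_const_smul c).comp (continuous_const_mul _)) ((continuous_const_mul _).comp (continuous_const_smul c))
    | h b => simp only [← map_smul, ← of_mul, mul_smul_comm]

theorem star_star' (x : CStarEnvelope B) : star (star x) = x := by
  induction x using induction_on with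
  | hc => exact isClosed_eq (by fun_prop) (by fun_prop)
  | h a => rw [← of_star, ← of_star, star_star]

theorem star_mul' (x y : CStarEnvelope B) : star (x * y) = star y * star x := by
  induction x using induction_on with
  | hc => exact isClosed_eq (by fun_prop) (by fun_prop)
  | h a =>
    induction y using induction_on with
    | hc => exact isClosed_eq (by fun_prop) (by fun_prop)
    | h b => simp only [← of_mul, ← of_star, star_mul]

theorem star_add' (x y : CStarEnvelope B) : star (x + y) = star x + star y := by
  induction x using induction_on with
  | hc => exact isClosed_eq (by fun_prop) (by fun_prop)
  | h a =>
    induction y using induction_on with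
    | hc => exact isClosed_eq (by fun_prop) (by fun_prop)
    | h b => simp only [← map_add, ← of_star, star_add]

theorem norm_mul_self_le' (x : CStarEnvelope B) : ‖x‖ * ‖x‖ ≤ ‖star x * x‖ := by
  induction x using induction_on with
  | hc => exact isClosed_le (by fun_prop) (by fun_prop)
  | h a => simpa only [← of_star, ← of_mul, norm_of] using PreEnvelope.norm_mul_self_le a

theorem star_smul' [StarModule ℂ B] (c : ℂ) (x : CStarEnvelope B) :
    star (c • x) = star c • star x := by
  induction x using induction_on with
  | hc => exact isClosed_eq (continuous_star'.comp (continuous_const_smul c)) ((continuous_const_smul _).comp continuous_star')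
  | h a => simp only [← map_smul, ← of_star, star_smul]

instance : NonUnitalNormedRing (CStarEnvelope B) :=
  { (inferInstance : NormedAddCommGroup (CStarEnvelope B)),
    (inferInstance : Mul (CStarEnvelope B)) with
    left_distrib := mul_add'
    right_distrib := add_mul'
    zero_mul := zero_mul'
    mul_zero := mul_zero'
    mul_assoc := mul_assoc'
    norm_mul_le := norm_mul_le' }

instance : StarRing (CStarEnvelope B) where
  star_involutive := star_star'
  star_mul := star_mul'
  star_add := star_add'

instance : CStarRing (CStarEnvelope B) := ⟨norm_mul_self_le'⟩

instance : IsScalarTower ℂ (CStarEnvelope B) (CStarEnvelope B) := ⟨smul_mul'⟩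

instance : SMulCommClass ℂ (CStarEnvelope B) (CStarEnvelope B) := ⟨mul_smul'⟩

instance [StarModule ℂ B] : StarModule ℂ (CStarEnvelope B) := ⟨star_smul'⟩

instance [StarModule ℂ B] : NonUnitalCStarAlgebra (CStarEnvelope B) where

end CStarEnvelope

end Envelope

/-- The crossed product C*-algebra `A ⋊_α G` of a C*-dynamical system with discrete `G`: the
enveloping C*-algebra of `ℓ¹(G, A; α)`. -/
abbrev CrossedProduct {G : Type u} [Group G] {A : Type v} [NonUnitalCStarAlgebra A]
    (α : G →* (A ≃⋆ₐ[ℂ] A)) : Type (max u v) :=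
  CStarEnvelope (L1Algebra α)

end

/-! Amenability follows from the existence of a virtual diagonal, an element `M` of the bidual of
the projective tensor product `B ⊗ B` with `c · M = M · c` and `π(M) · c = c`, where `π` is
multiplication. Bounded bilinear forms are the dual of that tensor product, so `M` is taken as a
functional on `BilForm B`. Writing `M` formally as `∑ a ⊗ b`, the functional `∑ a · D b` implements
a derivation `D` up to terms that measure how far the dual module is from being essential on the
left. These correct themselves (`IsVirtualDiagonal.isAmenableBanachAlgebra`).

The virtual diagonal is built in three stages. For `A`, the tensors `u e ⊗ e u*` are averaged, with
`e` running through an approximate unit and `u` through the unitary group of the unitization. Left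
invariance of the mean gives commutation with unitaries, and unitaries span. Such a mean exists
because the unitary group is abelian (Markov–Kakutani) or compact (Haar measure), according to the
case.

For `ℓ¹(G, A; α)`, write `u_g` for the formal unitary of `g`, so that `single g a` is `a u_g`. If
`N` is a virtual diagonal of `A`, then the mean over `g` of `u_g N u_g⁻¹` is one of `ℓ¹(G, A; α)`:
averaging makes it commute with the `u_h` while commutation with `A` survives.

Finally, the canonical map to the enveloping C*-algebra is a contractive homomorphism with dense
range, and virtual diagonals push forward along such maps. -/

noncomputable section

open scoped ENNReal BoundedContinuousFunction

open ContinuousLinearMap Filter Topology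

/-! ### Bounded bilinear forms -/

/-- The bounded bilinear forms on a normed space. -/
def BilForm (E : Type*) [NormedAddCommGroup E] [NormedSpace ℂ E] : Type _ := E →L[ℂ] E →L[ℂ] ℂ

namespace BilForm

variable {E V : Type*} [NormedAddCommGroup E] [NormedSpace ℂ E] [NormedAddCommGroup V]
  [NormedSpace ℂ V]

instance : NormedAddCommGroup (BilForm E) :=
  inferInstanceAs (NormedAddCommGroup (E →L[ℂ] E →L[ℂ] ℂ))

instance : NormedSpace ℂ (BilForm E) := inferInstanceAs (NormedSpace ℂ (E →L[ℂ] E →L[ℂ] ℂ))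

instance : CoeFun (BilForm E) fun _ => E → E → ℂ :=
  ⟨fun β a b => (show E →L[ℂ] E →L[ℂ] ℂ from β) a b⟩

theorem ext {β γ : BilForm E} (h : ∀ a b, β a b = γ a b) : β = γ :=
  ContinuousLinearMap.ext fun a => ContinuousLinearMap.ext fun b => h a b

theorem add_apply (β γ : BilForm E) (a b : E) : (β + γ) a b = β a b + γ a b := rfl

theorem smul_apply (c : ℂ) (β : BilForm E) (a b : E) : (c • β) a b = c • β a b := rfl

theorem zero_apply (a b : E) : (0 : BilForm E) a b = 0 := rfl

theorem norm_apply_le (β : BilForm E) (a b : E) : ‖β a b‖ ≤ ‖β‖ * ‖a‖ * ‖b‖ :=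
  le_opNorm₂ (show E →L[ℂ] E →L[ℂ] ℂ from β) a b

theorem norm_le_of_forall {β : BilForm E} {C : ℝ} (hC : 0 ≤ C)
    (h : ∀ a b, ‖β a b‖ ≤ C * ‖a‖ * ‖b‖) : ‖β‖ ≤ C :=
  opNorm_le_bound₂ (show E →L[ℂ] E →L[ℂ] ℂ from β) hC h

variable (E) in
/-- The identity, from nested bounded linear maps to bilinear forms. -/
def of : (E →L[ℂ] E →L[ℂ] ℂ) →L[ℂ] BilForm E :=
  ⟨{ toFun := fun β => β, map_add' := fun _ _ => rfl, map_smul' := fun _ _ => rfl }, continuous_id⟩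

variable (E) in
/-- The identity, from bilinear forms to nested bounded linear maps. -/
def curry : BilForm E →L[ℂ] (E →L[ℂ] E →L[ℂ] ℂ) :=
  ⟨{ toFun := fun β => β, map_add' := fun _ _ => rfl, map_smul' := fun _ _ => rfl }, continuous_id⟩

/-- The map `β ↦ ((x, y) ↦ β (S x) (T y))` on bounded bilinear forms. -/
def pullback (S T : V →L[ℂ] E) : BilForm E →L[ℂ] BilForm V :=
  (of V).comp ((((compL ℂ V E (V →L[ℂ] ℂ)).flip S).comp
    (compL ℂ E (E →L[ℂ] ℂ) (V →L[ℂ] ℂ) ((compL ℂ V E ℂ).flip T))).comp (curry E))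

theorem pullback_apply (S T : V →L[ℂ] E) (β : BilForm E) (x y : V) :
    pullback S T β x y = β (S x) (T y) := rfl

theorem norm_pullback_le {S T : V →L[ℂ] E} (hS : ∀ x, ‖S x‖ ≤ ‖x‖) (hT : ∀ x, ‖T x‖ ≤ ‖x‖)
    (β : BilForm E) : ‖pullback S T β‖ ≤ ‖β‖ := by
  refine norm_le_of_forall (norm_nonneg β) fun x y => ?_
  rw [pullback_apply]
  refine (β.norm_apply_le _ _).trans ?_
  gcongr
  · exact hS x
  · exact hT y

end BilForm

/-! ### Virtual diagonals and amenability -/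

variable {B : Type u} [NonUnitalNormedRing B] [NormedSpace ℂ B]
  [IsScalarTower ℂ B B] [SMulCommClass ℂ B B]

/-- `c ↦ ((a, b) ↦ β (c * a) b)`. -/
def leftMulForm (β : BilForm B) : B →L[ℂ] BilForm B :=
  (BilForm.of B).comp ((compL ℂ B B (B →L[ℂ] ℂ) (BilForm.curry B β)).comp (mul ℂ B))

/-- `c ↦ ((a, b) ↦ β a (b * c))`. -/
def rightMulForm (β : BilForm B) : B →L[ℂ] BilForm B :=
  (BilForm.of B).comp (((compL ℂ B (B →L[ℂ] ℂ) (B →L[ℂ] ℂ)).flip (BilForm.curry B β)).comp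
    ((compL ℂ B B ℂ).flip.comp (mul ℂ B).flip))

/-- `c ↦ ((a, b) ↦ f (a * b * c))`. -/
def productForm (f : B →L[ℂ] ℂ) : B →L[ℂ] BilForm B :=
  (BilForm.of B).comp (((compL ℂ B (B →L[ℂ] B) (B →L[ℂ] ℂ)).flip (mul ℂ B)).comp
    ((compL ℂ B B ℂ).comp ((compL ℂ B B ℂ f).comp (mul ℂ B).flip)))

/-- A virtual diagonal of `B`, as a bounded functional on the bounded bilinear forms on `B`: it does
not distinguish `(a, b) ↦ β (c * a) b` from `(a, b) ↦ β a (b * c)`, and it sends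
`(a, b) ↦ f (a * b * c)` to `f c`. -/
structure IsVirtualDiagonal (M : StrongDual ℂ (BilForm B)) : Prop where
  balanced : ∀ β : BilForm B, M.comp (leftMulForm β) = M.comp (rightMulForm β)
  unital : ∀ f : B →L[ℂ] ℂ, M.comp (productForm f) = f

namespace IsVirtualDiagonal

variable {M : StrongDual ℂ (BilForm B)}

theorem eq_of_balanced (hM : IsVirtualDiagonal M) (β : BilForm B)
    {β₁ β₂ : BilForm B} (c : B)
    (h₁ : ∀ a b, β₁ a b = β (c * a) b) (h₂ : ∀ a b, β₂ a b = β a (b * c)) : M β₁ = M β₂ := by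
  have e₁ : β₁ = leftMulForm β c := BilForm.ext h₁
  have e₂ : β₂ = rightMulForm β c := BilForm.ext h₂
  rw [e₁, e₂]
  exact DFunLike.congr_fun (hM.balanced β) c

theorem eq_of_unital (hM : IsVirtualDiagonal M) {β : BilForm B} (f : B →L[ℂ] ℂ) (c : B)
    (h : ∀ a b, β a b = f (a * b * c)) : M β = f c := by
  have e : β = productForm f c := BilForm.ext h
  rw [e]
  exact DFunLike.congr_fun (hM.unital f) c

/-- Balancing the form `(a, b) ↦ f (a * b)` carries `c` from the far left to the far right. -/
theorem eq_of_unital_left (hM : IsVirtualDiagonal M) {β : BilForm B} (f : B →L[ℂ] ℂ)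
    (c : B) (h : ∀ a b, β a b = f (c * a * b)) : M β = f c := by
  let γ : BilForm B := (compL ℂ B B ℂ f).comp (mul ℂ B)
  rw [hM.eq_of_balanced γ (β₂ := rightMulForm γ c) c h fun _ _ => rfl]
  exact hM.eq_of_unital f c fun a b => congrArg f (mul_assoc a b c).symm

/-- A Banach algebra with a virtual diagonal is amenable. No unit is needed: the derivation splits
into a part that is essential for the left action and one on which the left action vanishes, and
both are inner. -/
theorem isAmenableBanachAlgebra (hM : IsVirtualDiagonal M) :
    IsAmenableBanachAlgebra.{u, w} B := by
  intro E _ _ _ X D hD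
  have hD' : ∀ (a b : B) (x : E), D (a * b) x = D b (X.right a x) + D a (X.left b x) := by
    intro a b x
    rw [hD a b]
    rfl
  -- With `M` written as `∑ a ⊗ b`, this is `φ = ∑ a · D b`.
  let φ : StrongDual ℂ E :=
    M.comp ((BilForm.of B).comp ((compL ℂ B E (B →L[ℂ] ℂ) D.flip).comp X.right.flip))
  have hφ : ∀ x, φ x = M (BilForm.of B (D.flip.comp (X.right.flip x))) := fun _ => rfl
  -- `K f` is the form `(a, b) ↦ f (a * b)`. Hence `P ψ = ∑ (a * b) · ψ` and `η = ∑ D (a * b)`. `P`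
  -- acts as the projection onto the left essential part.
  let K : (B →L[ℂ] ℂ) →L[ℂ] BilForm B := (BilForm.of B).comp
    (((compL ℂ B (B →L[ℂ] B) (B →L[ℂ] ℂ)).flip (mul ℂ B)).comp (compL ℂ B B ℂ))
  let P : StrongDual ℂ E → StrongDual ℂ E := fun ψ =>
    (M.comp K).comp ((compL ℂ B E ℂ ψ).comp X.right.flip)
  have hP : ∀ ψ x, P ψ x = M (K (ψ.comp (X.right.flip x))) := fun _ _ => rfl
  let η : StrongDual ℂ E := (M.comp K).comp D.flip
  have hη : ∀ x, η x = M (K (D.flip x)) := fun _ => rfl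
  -- That is, `c · P ψ = c · ψ`: the difference `ψ - P ψ` is killed by the left action.
  have hPr : ∀ ψ c x, P ψ (X.right c x) = ψ (X.right c x) := by
    intro ψ c x
    rw [hP]
    refine hM.eq_of_unital_left (ψ.comp (X.right.flip x)) c fun a b => ?_
    change ψ (X.right (a * b) (X.right c x)) = ψ (X.right (c * a * b) x)
    rw [mul_assoc, X.right_mul c]
  -- That is, `c · φ - φ · c = P (D c)`: balance `c` across `M`, then expand `D (b * c)` by the
  -- derivation rule.
  have hφc : ∀ c x, φ (X.right c x) = P (D c) x + φ (X.left c x) := by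
    intro c x
    let β : BilForm B := D.flip.comp (X.right.flip x)
    rw [hφ, hφ, hP, ← map_add]
    refine hM.eq_of_balanced β c (fun a b => ?_) fun a b => ?_
    · change D b (X.right a (X.right c x)) = D b (X.right (c * a) x)
      rw [X.right_mul]
    · change D c (X.right (a * b) x) + D b (X.right a (X.left c x)) = D (b * c) (X.right a x)
      rw [hD', X.right_mul, X.left_right]
  have hηc : ∀ c x, η (X.left c x) = D c x - P (D c) x := by
    -- That is, `η · c = D c - P (D c)`, from the derivation rule for `D (a * b * c)`.
    intro c x
    rw [hη, hP, eq_sub_iff_add_eq, ← map_add]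
    refine hM.eq_of_unital (D.flip x) c fun a b => ?_
    change D (a * b) (X.left c x) + D c (X.right (a * b) x) = D (a * b * c) x
    rw [hD' (a * b) c, add_comm]
  -- That is, `P η · c = 0`: by `hηc`, `η · c` has the form `ψ - P ψ`, which the left action kills.
  have hPη : ∀ c x, P η (X.left c x) = 0 := by
    intro c x
    have h : K (η.comp (X.right.flip (X.left c x))) = 0 := by
      refine BilForm.ext fun a b => ?_
      change η (X.right (a * b) (X.left c x)) = 0
      rw [X.left_right, hηc, hPr, sub_self]
    rw [hP, h, map_zero]
  -- `φ` implements `P ∘ D`. Since `c · (η - P η) = 0` and `(η - P η) · c = D c - P (D c)`,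
  -- subtracting `η - P η` supplies the rest of `D`.
  refine ⟨φ - (η - P η), fun c => ContinuousLinearMap.ext fun x => ?_⟩
  change D c x = (φ (X.right c x) - (η (X.right c x) - P η (X.right c x))) -
    (φ (X.left c x) - (η (X.left c x) - P η (X.left c x)))
  rw [hPr, hφc, hηc, hPη]
  ring

/-- Virtual diagonals push forward along bounded homomorphisms with dense range. -/
theorem map (hM : IsVirtualDiagonal M) {C : Type v} [NonUnitalNormedRing C] [NormedSpace ℂ C]
    [IsScalarTower ℂ C C] [SMulCommClass ℂ C C] (θ : B →L[ℂ] C)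
    (hθ : ∀ a b, θ (a * b) = θ a * θ b) (hd : DenseRange θ) :
    ∃ N : StrongDual ℂ (BilForm C), IsVirtualDiagonal N := by
  let R := BilForm.pullback θ θ
  have hext : ∀ S T : C →L[ℂ] ℂ, (∀ c, S (θ c) = T (θ c)) → S = T := fun S T h =>
    DFunLike.coe_injective (hd.equalizer S.continuous T.continuous (funext h))
  refine ⟨M.comp R, ⟨fun β => hext _ _ fun c => ?_, fun f => hext _ _ fun c => ?_⟩⟩
  · refine hM.eq_of_balanced (R β) c (fun a b => ?_) fun a b => ?_
    · change β (θ c * θ a) (θ b) = β (θ (c * a)) (θ b)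
      rw [hθ]
    · change β (θ a) (θ b * θ c) = β (θ a) (θ (b * c))
      rw [hθ]
  · refine hM.eq_of_unital (f.comp θ) c fun a b => ?_
    change f (θ a * θ b * θ c) = f (θ (a * b * c))
    rw [hθ, hθ]

end IsVirtualDiagonal

/-! ### Averaging over the group: virtual diagonals of `ℓ¹(G, A; α)` -/

theorem mean_eq_of_const {G : Type u} (m : lp (fun _ : G => ℂ) ∞ →L[ℂ] ℂ) (hm : m 1 = 1) {k : ℂ}
    (F : lp (fun _ : G => ℂ) ∞) (hF : ∀ g, F g = k) : m F = k := by
  have h : F = k • (1 : lp (fun _ : G => ℂ) ∞) :=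
    lp.ext (funext fun g => (hF g).trans (mul_one k).symm)
  rw [h, map_smul, hm, smul_eq_mul, mul_one]

/-- A mean on `ℓ^∞(G)`, applied pointwise to a bounded family of functionals. -/
theorem exists_mean_functional {G : Type u} (m : lp (fun _ : G => ℂ) ∞ →L[ℂ] ℂ)
    {V : Type*} [NormedAddCommGroup V] [NormedSpace ℂ V] (Λ : G → StrongDual ℂ V) (C : ℝ)
    (hΛ : ∀ g v, ‖Λ g v‖ ≤ C * ‖v‖) :
    ∃ M : StrongDual ℂ V, ∀ (v : V) (f : lp (fun _ : G => ℂ) ∞), (∀ g, f g = Λ g v) →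
      M v = m f := by
  let F : V →ₗ[ℂ] lp (fun _ : G => ℂ) ∞ :=
    { toFun := fun v => ⟨fun g => Λ g v, memℓp_infty ⟨C * ‖v‖, by rintro _ ⟨g, rfl⟩; exact hΛ g v⟩⟩
      map_add' := fun v w => lp.ext (funext fun g => map_add (Λ g) v w)
      map_smul' := fun c v => lp.ext (funext fun g => map_smul (Λ g) c v) }
  have hF : ∀ v, ‖F v‖ ≤ |C| * ‖v‖ := fun v =>
    lp.norm_le_of_forall_le (by positivity) fun g =>
      (hΛ g v).trans (mul_le_mul_of_nonneg_right (le_abs_self C) (norm_nonneg v))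
  refine ⟨m.comp (F.mkContinuous |C| hF), fun v f h => congrArg m ?_⟩
  exact lp.ext (funext fun g => (h g).symm)

variable {G : Type u} [Group G] {A : Type v} [NonUnitalCStarAlgebra A]
  {α : G →* (A ≃⋆ₐ[ℂ] A)}

namespace L1Algebra

theorem norm_single (g : G) (a : A) : ‖single α g a‖ = ‖a‖ := by
  classical
  exact lp.norm_single (E := fun _ : G => A) (p := 1) (by simp) g a

theorem single_add (g : G) (a b : A) : single α g (a + b) = single α g a + single α g b := by
  classical
  exact lp.single_add (E := fun _ : G => A) 1 g a b

theorem single_smul (g : G) (c : ℂ) (a : A) : single α g (c • a) = c • single α g a := by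
  classical
  exact lp.single_smul (E := fun _ : G => A) 1 g c a

variable (α) in
/-- The isometric embedding `a ↦ single g a` of `A`. -/
def singleL (g : G) : A →L[ℂ] L1Algebra α :=
  LinearMap.mkContinuous
    { toFun := single α g
      map_add' := single_add g
      map_smul' := single_smul g } 1 fun a => by
        rw [one_mul]
        exact (norm_single g a).le

theorem singleL_apply (g : G) (a : A) : singleL α g a = single α g a := rfl

variable (α) in
/-- The automorphism `α g` as a bounded linear map. -/
def actL (g : G) : A →L[ℂ] A :=
  LinearMap.mkContinuous
    { toFun := α g
      map_add' := map_add (α g)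
      map_smul' := map_smul (α g) } 1 fun a => by
        rw [one_mul]
        exact (norm_act g a).le

/-- Finite sums of elements `single g a` are dense, so both axioms of a virtual diagonal need
checking only at one such element. -/
theorem continuousLinearMap_ext {V : Type*} [NormedAddCommGroup V] [NormedSpace ℂ V]
    {S T : L1Algebra α →L[ℂ] V} (h : ∀ g a, S (single α g a) = T (single α g a)) : S = T := by
  ext f
  induction f using induction_on with
  | hc => exact isClosed_eq S.continuous T.continuous
  | h0 => simp
  | ha f f' h1 h2 => simp only [map_add, h1, h2]
  | hs g a => exact h g a

/-- If `G` is amenable and `A` has a virtual diagonal, then so has `ℓ¹(G, A; α)`. -/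
theorem exists_isVirtualDiagonal (hG : IsAmenableGroup G)
    {N : StrongDual ℂ (BilForm A)} (hN : IsVirtualDiagonal N) :
    ∃ M : StrongDual ℂ (BilForm (L1Algebra α)), IsVirtualDiagonal M := by
  obtain ⟨m, -, hm1, hm⟩ := hG
  -- Here `S g a` is `α_g(a) u_g = u_g a`, so `R g` evaluates a form at `u_g a` and `b u_g⁻¹`.
  let S : G → A →L[ℂ] L1Algebra α := fun g => (singleL α g).comp (actL α g)
  have hS : ∀ g a, S g a = single α g (α g a) := fun _ _ => rfl
  let R := fun g => BilForm.pullback (S g) (singleL α g⁻¹)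
  have hR1 : ∀ g β, ‖R g β‖ ≤ ‖β‖ := fun g β => by
    refine BilForm.norm_pullback_le (fun a => ?_) (fun a => ?_) β
    · rw [hS, norm_single, norm_act]
    · rw [singleL_apply, norm_single]
  obtain ⟨C, hC, hNC⟩ := N.bound
  have hΛ : ∀ g β, ‖N (R g β)‖ ≤ C * ‖β‖ := fun g β =>
    (hNC _).trans (mul_le_mul_of_nonneg_left (hR1 g β) hC.le)
  obtain ⟨M, hM⟩ := exists_mean_functional m (fun g => N.comp (R g)) C hΛ
  let F : BilForm (L1Algebra α) → lp (fun _ : G => ℂ) ∞ := fun β =>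
    ⟨fun g => N (R g β), memℓp_infty ⟨C * ‖β‖, by rintro _ ⟨g, rfl⟩; exact hΛ g β⟩⟩
  have hMF : ∀ β, M β = m (F β) := fun β => hM β _ fun _ => rfl
  refine ⟨M, ⟨fun β => continuousLinearMap_ext fun h c => ?_,
    fun f => continuousLinearMap_ext fun h c => ?_⟩⟩
  · change M (leftMulForm β (single α h c)) = M (rightMulForm β (single α h c))
    -- Translation replaces `g` by `h g` on the right-hand side only. Both sides then involve the
    -- same element `c' = α_{(hg)⁻¹}(c)` of `A`: `c u_h u_g a = u_{hg} c' a` and `b u_{hg}⁻¹ c u_h =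
    -- b c' u_g⁻¹`. Balancedness of `N` at `c'` concludes.
    rw [hMF, hMF, ← hm h⁻¹ (F (rightMulForm β _))]
    refine congrArg m (lp.ext (funext fun g => ?_))
    change N (R g _) = N (R (h⁻¹⁻¹ * g) _)
    rw [inv_inv]
    refine hN.eq_of_balanced (BilForm.pullback (S (h * g)) (singleL α g⁻¹) β) (α (h * g)⁻¹ c)
      (fun a b => ?_) fun a b => ?_
    · change β (single α h c * single α g (α g a)) _ = β (single α (h * g) (α (h * g) _)) _
      rw [single_mul_single, map_mul (α (h * g)), act_act, act_act, mul_inv_cancel, map_one,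
        StarAlgEquiv.one_apply]
    · change β (single α (h * g) (α (h * g) a)) (single α (h * g)⁻¹ b * single α h c) =
        β (single α (h * g) (α (h * g) a)) (single α g⁻¹ (b * α (h * g)⁻¹ c))
      rw [single_mul_single, mul_inv_rev, inv_mul_cancel_right]
  · change M (productForm f (single α h c)) = _
    -- `u_g a b u_g⁻¹ c u_h = α_g(a b α_{g⁻¹}(c)) u_h`, so unitality of `N` gives a value
    -- independent of `g`.
    have key : ∀ g, N (R g (productForm f (single α h c))) = f (single α h c) := by
      intro g
      refine (hN.eq_of_unital (f.comp (singleL α h ∘L actL α g)) (α g⁻¹ c) fun a b => ?_).trans ?_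
      · change f (single α g (α g a) * single α g⁻¹ b * single α h c) =
          f (single α h (α g (a * b * α g⁻¹ c)))
        rw [single_mul_single, single_mul_single, map_mul (α g), map_mul (α g), act_act g g⁻¹,
          mul_inv_cancel, one_mul, map_one, StarAlgEquiv.one_apply]
      · change f (single α h (α g (α g⁻¹ c))) = _
        rw [act_act, mul_inv_cancel, map_one, StarAlgEquiv.one_apply]
    rw [hMF]
    exact mean_eq_of_const m hm1 _ key

end L1Algebra

/-! ### Passage to the enveloping C*-algebra -/

/-- The enveloping C*-algebra inherits virtual diagonals. -/
theorem CStarEnvelope.exists_isVirtualDiagonal {B : Type u} [NonUnitalNormedRing B] [StarRing B]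
    [NormedSpace ℂ B] [IsScalarTower ℂ B B] [SMulCommClass ℂ B B] [NormedStarGroup B]
    [CompleteSpace B] {M : StrongDual ℂ (BilForm B)} (hM : IsVirtualDiagonal M) :
    ∃ N : StrongDual ℂ (BilForm (CStarEnvelope B)), IsVirtualDiagonal N := by
  let e : B →ₗ[ℂ] PreEnvelope B :=
    { toFun := fun b => b
      map_add' := fun _ _ => rfl
      map_smul' := fun _ _ => rfl }
  let θ : B →L[ℂ] CStarEnvelope B :=
    (CStarEnvelope.of.toLinearMap.comp e).mkContinuous 1 fun b => by
      rw [one_mul]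
      refine (CStarEnvelope.norm_of (e b)).trans_le ?_
      exact PreEnvelope.norm_le_of_forall fun H _ _ _ π => PreEnvelope.norm_rep_le (B := B) π b
  exact hM.map θ (fun a b => CStarEnvelope.of_mul (e a) (e b))
    (CStarEnvelope.isDenseInducing_of (B := B)).dense

/-! ### Invariant functionals of Markov–Kakutani type -/

/-- A bounded family of functionals converges pointwise along every ultrafilter. -/
theorem exists_tendsto_ultrafilter {ι V : Type*} [NormedAddCommGroup V] [NormedSpace ℂ V]
    (U : Ultrafilter ι) (Λ : ι → StrongDual ℂ V) (C : ℝ) (hΛ : ∀ᶠ i in U, ∀ v, ‖Λ i v‖ ≤ C * ‖v‖) :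
    ∃ L : StrongDual ℂ V, ∀ v, Tendsto (fun i => Λ i v) U (𝓝 (L v)) := by
  -- Banach–Alaoglu: closed balls of the dual are weak-* compact. The radius is `|C|` because the
  -- sign of `C` is not prescribed.
  have hK := WeakDual.isCompact_closedBall (𝕜 := ℂ) (E := V) 0 |C|
  let W : Ultrafilter (WeakDual ℂ V) := U.map fun i => StrongDual.toWeakDual (Λ i)
  obtain ⟨L, -, hL⟩ := hK.ultrafilter_le_nhds W (by
    refine le_principal_iff.2 (hΛ.mono fun i hi => ?_)
    change Λ i ∈ Metric.closedBall (0 : StrongDual ℂ V) |C|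
    rw [mem_closedBall_zero_iff]
    exact opNorm_le_bound _ (abs_nonneg C) fun v =>
      (hi v).trans (mul_le_mul_of_nonneg_right (le_abs_self C) (norm_nonneg v)))
  refine ⟨WeakDual.toStrongDual L, fun v => ?_⟩
  exact ((WeakDual.eval_continuous v).tendsto L).comp
    (tendsto_iff_comap.2 (map_le_iff_le_comap.1 hL))

theorem norm_pow_apply_le {V : Type*} [NormedAddCommGroup V] [NormedSpace ℂ V] {T : V →L[ℂ] V}
    (hT : ∀ v, ‖T v‖ ≤ ‖v‖) (k : ℕ) (v : V) : ‖(T ^ k) v‖ ≤ ‖v‖ := by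
  induction k generalizing v with
  | zero => simp
  | succ k ih =>
    rw [pow_succ]
    exact (ih (T v)).trans (hT v)

/-- A functional can be averaged to become invariant under a contraction. -/
theorem exists_invariant_functional_of_contraction {V : Type*} [NormedAddCommGroup V]
    [NormedSpace ℂ V] (T : V →L[ℂ] V) (hT : ∀ v, ‖T v‖ ≤ ‖v‖) (L : StrongDual ℂ V) (C : ℝ)
    (hC : ∀ v, ‖L v‖ ≤ C * ‖v‖) :
    ∃ L' : StrongDual ℂ V, (∀ v, ‖L' v‖ ≤ C * ‖v‖) ∧ (∀ v, L' (T v) = L' v) ∧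
      (∀ v, T v = v → L' v = L v) ∧
      ∀ S : V →L[ℂ] V, Commute S T → (∀ v, L (S v) = L v) → ∀ v, L' (S v) = L' v := by
  -- Cesàro means of the functionals `L ∘ T ^ k`; `L'` is their limit along an ultrafilter finer
  -- than `atTop`.
  let Λ : ℕ → StrongDual ℂ V := fun n =>
    ((n + 1 : ℕ) : ℂ)⁻¹ • ∑ k ∈ Finset.range (n + 1), L.comp (T ^ k)
  have hΛ : ∀ n v, Λ n v = ((n + 1 : ℕ) : ℂ)⁻¹ * ∑ k ∈ Finset.range (n + 1), L ((T ^ k) v) := by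
    intro n v
    simp [Λ]
  have hn : ∀ n : ℕ, ((n + 1 : ℕ) : ℂ) ≠ 0 := fun n => Nat.cast_ne_zero.2 n.succ_ne_zero
  have hle : ∀ k v, ‖L ((T ^ k) v)‖ ≤ C * ‖v‖ := by
    intro k v
    rcases le_or_gt 0 C with h0 | h0
    · exact (hC _).trans (mul_le_mul_of_nonneg_left (norm_pow_apply_le hT k v) h0)
    -- A negative `C` forces `V` to be zero.
    · have hv : ∀ w : V, ‖w‖ = 0 := fun w => by
        by_contra h
        have := (norm_nonneg w).lt_of_ne' h
        nlinarith [hC w, norm_nonneg (L w)]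
      have := hC ((T ^ k) v)
      rwa [hv, ← hv v] at this
  have hb : ∀ n v, ‖Λ n v‖ ≤ C * ‖v‖ := by
    intro n v
    rw [hΛ, norm_mul, norm_inv, Complex.norm_natCast]
    have h1 : ‖∑ k ∈ Finset.range (n + 1), L ((T ^ k) v)‖ ≤ (n + 1 : ℕ) * (C * ‖v‖) := by
      refine (norm_sum_le_of_le _ fun k _ => hle k v).trans_eq ?_
      simp
    rw [inv_mul_le_iff₀ (by positivity)]
    exact h1
  obtain ⟨L', hL'⟩ := exists_tendsto_ultrafilter (Ultrafilter.of (atTop : Filter ℕ)) Λ C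
    (Eventually.of_forall hb)
  refine ⟨L', fun v => ?_, fun v => ?_, fun v hv => ?_, fun S hS hLS v => ?_⟩
  · exact le_of_tendsto (hL' v).norm (Eventually.of_forall fun n => hb n v)
  · have h0 : Tendsto (fun n => Λ n (T v) - Λ n v) atTop (𝓝 0) := by
      -- The sum telescopes, leaving two bounded terms divided by `n + 1`.
      have hd : ∀ n, Λ n (T v) - Λ n v = ((n + 1 : ℕ) : ℂ)⁻¹ * (L ((T ^ (n + 1)) v) - L v) := by
        intro n
        have := Finset.sum_range_sub (fun k => L ((T ^ k) v)) (n + 1)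
        rw [hΛ, hΛ, ← mul_sub, ← Finset.sum_sub_distrib]
        simpa [pow_succ] using congrArg (((n + 1 : ℕ) : ℂ)⁻¹ * ·) this
      refine squeeze_zero_norm (a := fun n : ℕ => ((n : ℝ) + 1)⁻¹ * (C * ‖v‖ + C * ‖v‖))
        (fun n => ?_) ?_
      · rw [hd, norm_mul, norm_inv, Complex.norm_natCast, Nat.cast_add_one]
        refine mul_le_mul_of_nonneg_left ?_ (by positivity)
        exact (norm_sub_le _ _).trans (add_le_add (hle _ _) (hC v))
      · simpa using (tendsto_inv_atTop_zero.comp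
          (tendsto_atTop_add_const_right atTop (1 : ℝ) tendsto_natCast_atTop_atTop)).mul_const
            (C * ‖v‖ + C * ‖v‖)
    exact sub_eq_zero.1 (tendsto_nhds_unique ((hL' _).sub (hL' _))
      (h0.mono_left (Ultrafilter.of_le _)))
  · refine tendsto_nhds_unique (hL' v) (tendsto_const_nhds.congr fun n => ?_)
    have hk : ∀ k : ℕ, (T ^ k) v = v := fun k => by
      induction k with
      | zero => rfl
      | succ k ih => rw [pow_succ, mul_apply_eq_comp, hv, ih]
    simp only [hΛ, hk, Finset.sum_const, Finset.card_range, nsmul_eq_mul]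
    rw [inv_mul_cancel_left₀ (hn n)]
  · refine tendsto_nhds_unique (hL' (S v)) ((hL' v).congr fun n => ?_)
    rw [hΛ, hΛ]
    congr 1
    refine Finset.sum_congr rfl fun k _ => ?_
    rw [← hLS ((T ^ k) v)]
    exact congrArg L (DFunLike.congr_fun (hS.pow_right k).eq v)

/-- Given commuting contractions, every functional agrees on the vectors that they fix with an
invariant one. -/
theorem exists_invariant_functional {ι V : Type*} [NormedAddCommGroup V] [NormedSpace ℂ V]
    (T : ι → V →L[ℂ] V) (hT : ∀ i v, ‖T i v‖ ≤ ‖v‖) (hc : ∀ i j, Commute (T i) (T j))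
    (L : StrongDual ℂ V) :
    ∃ L' : StrongDual ℂ V, (∀ i v, L' (T i v) = L' v) ∧ ∀ v, (∀ i, T i v = v) → L' v = L v := by
  classical
  have hfin : ∀ s : Finset ι, ∃ L' : StrongDual ℂ V, (∀ v, ‖L' v‖ ≤ ‖L‖ * ‖v‖) ∧
      (∀ i ∈ s, ∀ v, L' (T i v) = L' v) ∧ ∀ v, (∀ i, T i v = v) → L' v = L v := by
    intro s
    induction s using Finset.induction_on with
    | empty => exact ⟨L, L.le_opNorm, by simp, fun _ _ => rfl⟩
    | insert j s hj ih =>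
      obtain ⟨L₁, hb, hi, hf⟩ := ih
      obtain ⟨L₂, hb₂, hi₂, hf₂, hs₂⟩ :=
        exists_invariant_functional_of_contraction (T j) (hT j) L₁ ‖L‖ hb
      -- Averaging over `T j` keeps the invariance already obtained, as the `T i` commute with `T
      -- j`. The bound `‖L‖` stays uniform in `s`, which the final limit needs.
      refine ⟨L₂, hb₂, fun i his v => ?_, fun v hv => (hf₂ v (hv j)).trans (hf v hv)⟩
      rcases Finset.mem_insert.1 his with rfl | his
      · exact hi₂ v
      · exact hs₂ (T i) (hc i j) (hi i his) v
  choose Λ hb hi hf using hfin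
  -- The ultrafilter refines the directed set of finite subsets, so each `i` eventually lies in `s`.
  obtain ⟨L', hL'⟩ := exists_tendsto_ultrafilter (Ultrafilter.of (atTop : Filter (Finset ι))) Λ ‖L‖
    (Eventually.of_forall hb)
  refine ⟨L', fun i v => ?_, fun v hv => ?_⟩
  · refine tendsto_nhds_unique (hL' (T i v)) ((hL' v).congr' ?_)
    refine (Ultrafilter.of_le (atTop : Filter (Finset ι))) ?_
    filter_upwards [eventually_ge_atTop {i}] with s hs
    exact (hi s i (Finset.singleton_subset_iff.1 hs) v).symm
  · exact tendsto_nhds_unique (hL' v) (tendsto_const_nhds.congr fun s => (hf s v hv).symm)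

/-! ### Invariant means on abelian and on compact groups -/

/-- A topological group has a left invariant mean on its bounded continuous functions. -/
def HasInvariantMean (U : Type*) [Group U] [TopologicalSpace U] [ContinuousMul U] : Prop :=
  ∃ m : StrongDual ℂ (U →ᵇ ℂ), (∀ (F : U →ᵇ ℂ) (k : ℂ), (∀ u, F u = k) → m F = k) ∧
    ∀ (v : U) (F F' : U →ᵇ ℂ), (∀ u, F' u = F (v * u)) → m F' = m F

theorem hasInvariantMean_of_commute {U : Type*} [Group U] [TopologicalSpace U] [ContinuousMul U]
    (hU : ∀ u v : U, u * v = v * u) : HasInvariantMean U := by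
  let T : U → (U →ᵇ ℂ) →L[ℂ] (U →ᵇ ℂ) := fun v =>
    LinearMap.mkContinuous
      { toFun := fun F => F.compContinuous ⟨(v * ·), continuous_const_mul v⟩
        map_add' := fun _ _ => rfl
        map_smul' := fun _ _ => rfl } 1 fun F => by
          rw [one_mul]
          exact (BoundedContinuousFunction.norm_le (norm_nonneg F)).2 fun u => F.norm_coe_le_norm _
  have hT : ∀ v F u, T v F u = F (v * u) := fun _ _ _ => rfl
  -- Constant functions are fixed by all translations, so the invariant functional retains the
  -- values of this evaluation on them.
  let L : StrongDual ℂ (U →ᵇ ℂ) := BoundedContinuousFunction.evalCLM ℂ 1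
  obtain ⟨m, hm, hf⟩ := exists_invariant_functional T
    (fun v F => (BoundedContinuousFunction.norm_le (norm_nonneg F)).2 fun u => F.norm_coe_le_norm _)
    (fun v w => by
      ext F u
      change F (w * (v * u)) = F (v * (w * u))
      rw [← mul_assoc, ← mul_assoc, hU w v]) L
  refine ⟨m, fun F k hF => ?_, fun v F F' h => ?_⟩
  · rw [hf F fun v => by ext u; rw [hT, hF, hF]]
    exact hF 1
  · rw [← hm v F]
    congr 1
    ext u
    exact h u

theorem hasInvariantMean_of_compact {U : Type*} [Group U] [TopologicalSpace U]
    [IsTopologicalGroup U] [CompactSpace U] : HasInvariantMean U := by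
  let _ : MeasurableSpace U := borel U
  have : BorelSpace U := ⟨rfl⟩
  -- Normalizing on `⊤`, the whole compact group, makes Haar measure a probability measure.
  let μ : MeasureTheory.Measure U := MeasureTheory.Measure.haarMeasure ⊤
  have : MeasureTheory.IsProbabilityMeasure μ :=
    ⟨MeasureTheory.Measure.haarMeasure_self (K₀ := ⊤)⟩
  have hint : ∀ F : U →ᵇ ℂ, MeasureTheory.Integrable F μ := fun F => F.integrable μ
  let m : (U →ᵇ ℂ) →ₗ[ℂ] ℂ :=
    { toFun := fun F => ∫ u, F u ∂μ
      map_add' := fun F F' => MeasureTheory.integral_add (hint F) (hint F')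
      map_smul' := fun c F => MeasureTheory.integral_const_mul c _ }
  refine ⟨m.mkContinuous 1 fun F => ?_, fun F k hF => ?_, fun v F F' h => ?_⟩
  · rw [one_mul]
    exact F.norm_integral_le_norm μ
  · change ∫ u, F u ∂μ = k
    simp [hF]
  · change ∫ u, F' u ∂μ = ∫ u, F u ∂μ
    simp_rw [h]
    exact MeasureTheory.integral_mul_left_eq_self F v

/-- An invariant mean, applied pointwise to a bounded pointwise continuous family of functionals. -/
theorem exists_pointwise_mean {U : Type*} [TopologicalSpace U] (m : StrongDual ℂ (U →ᵇ ℂ))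
    {V : Type*} [NormedAddCommGroup V] [NormedSpace ℂ V] (Λ : U → StrongDual ℂ V) (C : ℝ)
    (hΛ : ∀ u v, ‖Λ u v‖ ≤ C * ‖v‖) (hc : ∀ v, Continuous fun u => Λ u v) :
    ∃ M : StrongDual ℂ V, ∀ (v : V), ∃ F : U →ᵇ ℂ, (∀ u, F u = Λ u v) ∧ M v = m F := by
  let F : V →ₗ[ℂ] (U →ᵇ ℂ) :=
    { toFun := fun v => BoundedContinuousFunction.ofNormedAddCommGroup _ (hc v) (C * ‖v‖) fun u =>
        hΛ u v
      map_add' := fun v w => by ext u; exact map_add (Λ u) v w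
      map_smul' := fun c v => by ext u; exact map_smul (Λ u) c v }
  have hF : ∀ v, ‖F v‖ ≤ |C| * ‖v‖ := fun v =>
    (BoundedContinuousFunction.norm_le (by positivity)).2 fun u =>
      (hΛ u v).trans (mul_le_mul_of_nonneg_right (le_abs_self C) (norm_nonneg v))
  exact ⟨m.comp (F.mkContinuous |C| hF), fun v => ⟨F v, fun _ => rfl, rfl⟩⟩

/-! ### The action of the unitization on `A` and on bilinear forms -/

namespace Unitization

variable {A : Type u} [NonUnitalCStarAlgebra A]

/-- Left multiplication of `A` by an element of its unitization. -/
def lact (x : Unitization ℂ A) : A →L[ℂ] A := x.fst • .id ℂ A + mul ℂ A x.snd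

/-- Right multiplication of `A` by an element of its unitization. -/
def ract (x : Unitization ℂ A) : A →L[ℂ] A := x.fst • .id ℂ A + (mul ℂ A).flip x.snd

theorem lact_apply (x : Unitization ℂ A) (a : A) : lact x a = x.fst • a + x.snd * a := rfl

theorem ract_apply (x : Unitization ℂ A) (a : A) : ract x a = x.fst • a + a * x.snd := rfl

theorem inr_lact (x : Unitization ℂ A) (a : A) : (lact x a : Unitization ℂ A) = x * a := by
  ext <;> simp [lact_apply]

theorem inr_ract (x : Unitization ℂ A) (a : A) : (ract x a : Unitization ℂ A) = a * x := by
  ext <;> simp [ract_apply]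

theorem lact_mul (x y : Unitization ℂ A) (a : A) : lact (x * y) a = lact x (lact y a) :=
  Unitization.inr_injective (R := ℂ) (by simp only [inr_lact, mul_assoc])

theorem ract_mul (x y : Unitization ℂ A) (a : A) : ract (x * y) a = ract y (ract x a) :=
  Unitization.inr_injective (R := ℂ) (by simp only [inr_ract, mul_assoc])

theorem lact_one (a : A) : lact (1 : Unitization ℂ A) a = a := by simp [lact_apply]

theorem ract_one (a : A) : ract (1 : Unitization ℂ A) a = a := by simp [ract_apply]

theorem ract_mul_eq (x : Unitization ℂ A) (a b : A) : ract x a * b = a * lact x b :=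
  Unitization.inr_injective (R := ℂ) (by
    simp only [Unitization.inr_mul, inr_lact, inr_ract, mul_assoc])

theorem lact_mul_eq (x : Unitization ℂ A) (a b : A) : lact x a * b = lact x (a * b) :=
  Unitization.inr_injective (R := ℂ) (by
    simp only [Unitization.inr_mul, inr_lact, mul_assoc])

/-- Used, with its right-handed counterpart, to pass from unitaries to arbitrary elements by writing
these as combinations of unitaries. -/
theorem lact_sum_smul {κ : Type*} (s : Finset κ) (k : κ → ℂ) (x : κ → Unitization ℂ A) (a : A) :
    lact (∑ i ∈ s, k i • x i) a = ∑ i ∈ s, k i • lact (x i) a := by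
  classical
  induction s using Finset.induction_on with
  | empty => simp [lact_apply]
  | insert i s hi ih =>
    rw [Finset.sum_insert hi, Finset.sum_insert hi, ← ih]
    simp only [lact_apply, Unitization.fst_add, Unitization.snd_add, Unitization.fst_smul,
      Unitization.snd_smul, add_smul, add_mul, smul_add, smul_assoc, smul_mul_assoc]
    abel

theorem ract_sum_smul {κ : Type*} (s : Finset κ) (k : κ → ℂ) (x : κ → Unitization ℂ A) (a : A) :
    ract (∑ i ∈ s, k i • x i) a = ∑ i ∈ s, k i • ract (x i) a := by
  classical
  induction s using Finset.induction_on with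
  | empty => simp [ract_apply]
  | insert i s hi ih =>
    rw [Finset.sum_insert hi, Finset.sum_insert hi, ← ih]
    simp only [ract_apply, Unitization.fst_add, Unitization.snd_add, Unitization.fst_smul,
      Unitization.snd_smul, add_smul, mul_add, smul_add, smul_assoc, mul_smul_comm]
    abel

theorem norm_lact_le (u : unitary (Unitization ℂ A)) (a : A) :
    ‖lact (u : Unitization ℂ A) a‖ ≤ ‖a‖ := by
  rw [← Unitization.norm_inr (𝕜 := ℂ), inr_lact, CStarRing.norm_coe_unitary_mul,
    Unitization.norm_inr]

theorem norm_ract_le (u : unitary (Unitization ℂ A)) (a : A) :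
    ‖ract (u : Unitization ℂ A) a‖ ≤ ‖a‖ := by
  rw [← Unitization.norm_inr (𝕜 := ℂ), inr_ract, CStarRing.norm_mul_coe_unitary,
    Unitization.norm_inr]

theorem continuous_lact : Continuous (lact : Unitization ℂ A → A →L[ℂ] A) := by
  have h1 : Continuous (fun x : Unitization ℂ A => x.fst) := Unitization.continuous_fst
  have h2 : Continuous (fun x : Unitization ℂ A => x.snd) := Unitization.continuous_snd
  exact (h1.smul continuous_const).add ((mul ℂ A).continuous.comp h2)

theorem continuous_ract : Continuous (ract : Unitization ℂ A → A →L[ℂ] A) := by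
  have h1 : Continuous (fun x : Unitization ℂ A => x.fst) := Unitization.continuous_fst
  have h2 : Continuous (fun x : Unitization ℂ A => x.snd) := Unitization.continuous_snd
  exact (h1.smul continuous_const).add ((mul ℂ A).flip.continuous.comp h2)

end Unitization

/-- The mean is defined only on continuous functions; norm continuity of the actions makes the
functions to be averaged continuous. -/
theorem BilForm.continuous_pullback {X : Type*} [TopologicalSpace X] {E : Type*}
    [NormedAddCommGroup E] [NormedSpace ℂ E]
    {S T : X → E →L[ℂ] E} (hS : Continuous S) (hT : Continuous T)
    (β : BilForm E) : Continuous fun x => BilForm.pullback (S x) (T x) β := by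
  have h : Continuous fun x => (compL ℂ E E ℂ).flip (T x) :=
    (compL ℂ E E ℂ).flip.continuous.comp hT
  exact (BilForm.of E).continuous.comp
    ((h.clm_comp (continuous_const (y := BilForm.curry E β))).clm_comp hS)

theorem BilForm.sum_smul_apply {κ E : Type*} [NormedAddCommGroup E] [NormedSpace ℂ E]
    (s : Finset κ) (k : κ → ℂ) (β : κ → BilForm E) (a b : E) :
    (∑ i ∈ s, k i • β i) a b = ∑ i ∈ s, k i • β i a b := by
  classical
  induction s using Finset.induction_on with
  | empty => simp [BilForm.zero_apply]
  | insert i s hi ih => rw [Finset.sum_insert hi, Finset.sum_insert hi, BilForm.add_apply, ih,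
      BilForm.smul_apply]

theorem BilForm.pullback_sum_left {κ E : Type*} [NormedAddCommGroup E] [NormedSpace ℂ E]
    (s : Finset κ) (k : κ → ℂ) (S : κ → E →L[ℂ] E) {S' T : E →L[ℂ] E}
    (h : ∀ x, S' x = ∑ i ∈ s, k i • S i x) (β : BilForm E) :
    BilForm.pullback S' T β = ∑ i ∈ s, k i • BilForm.pullback (S i) T β := by
  refine BilForm.ext fun x y => ?_
  rw [BilForm.sum_smul_apply]
  simp_rw [BilForm.pullback_apply, h]
  change BilForm.curry E β (∑ i ∈ s, k i • S i x) (T y) =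
    ∑ i ∈ s, k i • BilForm.curry E β (S i x) (T y)
  simp [map_sum]

theorem BilForm.pullback_sum_right {κ E : Type*} [NormedAddCommGroup E] [NormedSpace ℂ E]
    (s : Finset κ) (k : κ → ℂ) (T : κ → E →L[ℂ] E) {S T' : E →L[ℂ] E}
    (h : ∀ x, T' x = ∑ i ∈ s, k i • T i x) (β : BilForm E) :
    BilForm.pullback S T' β = ∑ i ∈ s, k i • BilForm.pullback S (T i) β := by
  refine BilForm.ext fun x y => ?_
  rw [BilForm.sum_smul_apply]
  simp_rw [BilForm.pullback_apply, h]
  simp [map_sum]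

/-! ### Averaging an approximate diagonal over the unitary group -/

/-- The limit of `β e e` along an ultrafilter in the unit ball. -/
theorem exists_diagonal_limit {E : Type*} [NormedAddCommGroup E] [NormedSpace ℂ E]
    (U : Ultrafilter E) (hU : ∀ᶠ e in (U : Filter E), ‖e‖ ≤ 1) :
    ∃ N : StrongDual ℂ (BilForm E), (∀ β, ‖N β‖ ≤ ‖β‖) ∧
      ∀ β, Tendsto (fun e => β e e) U (𝓝 (N β)) := by
  let Λ : E → StrongDual ℂ (BilForm E) := fun e =>
    ((ContinuousLinearMap.apply ℂ ℂ e).comp (ContinuousLinearMap.apply ℂ (E →L[ℂ] ℂ) e)).comp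
      (BilForm.curry E)
  have hΛ : ∀ e β, Λ e β = β e e := fun _ _ => rfl
  have hb : ∀ᶠ e in (U : Filter E), ∀ β, ‖Λ e β‖ ≤ 1 * ‖β‖ := by
    filter_upwards [hU] with e he β
    rw [hΛ, one_mul]
    refine (β.norm_apply_le e e).trans ?_
    rw [mul_assoc]
    exact mul_le_of_le_one_right (norm_nonneg β) (mul_le_one₀ he (norm_nonneg e) he)
  obtain ⟨N, hN⟩ := exists_tendsto_ultrafilter U Λ 1 hb
  exact ⟨N, fun β => le_of_tendsto (hN β).norm (hb.mono fun e he => (he β).trans_eq (one_mul _)),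
    hN⟩

/-- Averaging a functional on bilinear forms over a group acting on both variables. -/
theorem HasInvariantMean.exists_invariant_formFunctional {U : Type*} [Group U] [TopologicalSpace U]
    [ContinuousMul U] (hU : HasInvariantMean U) {E : Type*} [NormedAddCommGroup E]
    [NormedSpace ℂ E] {S T : U → E →L[ℂ] E} (hS : Continuous S) (hT : Continuous T)
    (hS1 : ∀ u x, ‖S u x‖ ≤ ‖x‖) (hT1 : ∀ u x, ‖T u x‖ ≤ ‖x‖)
    (hSm : ∀ u v x, S (u * v) x = S u (S v x)) (hTm : ∀ u v x, T (u * v) x = T u (T v x))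
    (L : StrongDual ℂ (BilForm E)) (hL : ∀ β, ‖L β‖ ≤ ‖β‖) :
    ∃ N : StrongDual ℂ (BilForm E), (∀ u β, N (BilForm.pullback (S u) (T u) β) = N β) ∧
      ∀ β k, (∀ u, L (BilForm.pullback (S u) (T u) β) = k) → N β = k := by
  obtain ⟨m, hm1, hm⟩ := hU
  obtain ⟨N, hN⟩ := exists_pointwise_mean m
    (fun u => L.comp (BilForm.pullback (S u) (T u))) 1
    (fun u β => ((hL _).trans (BilForm.norm_pullback_le (hS1 u) (hT1 u) β)).trans_eq
      (one_mul _).symm)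
    (fun β => L.continuous.comp (BilForm.continuous_pullback hS hT β))
  refine ⟨N, fun v β => ?_, fun β k hk => ?_⟩
  · obtain ⟨F, hF, hNF⟩ := hN β
    obtain ⟨F', hF', hNF'⟩ := hN (BilForm.pullback (S v) (T v) β)
    rw [hNF, hNF']
    refine hm v F F' fun u => ?_
    rw [hF, hF']
    refine congrArg L ?_
    refine BilForm.ext fun a b => ?_
    change β (S v (S u a)) (T v (T u b)) = β (S (v * u) a) (T (v * u) b)
    rw [hSm, hTm]
  · obtain ⟨F, hF, hNF⟩ := hN β
    rw [hNF]
    exact hm1 F k fun u => (hF u).trans (hk u)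

/-- The square `e * e` appears because multiplication sends the diagonal tensor `e ⊗ e` to it. -/
theorem exists_bounded_approximateUnit (A : Type u) [NonUnitalCStarAlgebra A] :
    ∃ U : Ultrafilter A, (∀ᶠ e in (U : Filter A), ‖e‖ ≤ 1) ∧
      ∀ x : A, Tendsto (fun e => e * (e * x)) U (𝓝 x) := by
  let _ := CStarAlgebra.spectralOrder A
  have _ := CStarAlgebra.spectralOrderedRing A
  have hl := CStarAlgebra.increasingApproximateUnit A
  let U : Ultrafilter A := Ultrafilter.of (CStarAlgebra.approximateUnit A)
  have hU : (U : Filter A) ≤ CStarAlgebra.approximateUnit A := Ultrafilter.of_le _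
  have hnorm : ∀ᶠ e in (U : Filter A), ‖e‖ ≤ 1 := hU hl.eventually_norm
  refine ⟨U, hnorm, fun x => ?_⟩
  have h1 : Tendsto (fun e => e * x) (U : Filter A) (𝓝 x) :=
    (hl.tendsto_mul_right x).mono_left hU
  -- Split `e * (e * x) = e * (e * x - x) + e * x`; the first term is controlled by `‖e‖ ≤ 1`.
  have h2 : Tendsto (fun e => e * (e * x - x)) (U : Filter A) (𝓝 0) := by
    refine squeeze_zero_norm' (a := fun e => ‖e * x - x‖) ?_ ?_
    · filter_upwards [hnorm] with e he
      exact (norm_mul_le _ _).trans (mul_le_of_le_one_left (norm_nonneg _) he)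
    · simpa using (h1.sub_const x).norm
  simpa [mul_sub] using h2.add h1

open Unitization in
/-- A C*-algebra has a virtual diagonal if the unitary group of its unitization has an invariant
mean. -/
theorem HasInvariantMean.exists_isVirtualDiagonal {A : Type u} [NonUnitalCStarAlgebra A]
    (hU : HasInvariantMean (unitary (Unitization ℂ A))) :
    ∃ N : StrongDual ℂ (BilForm A), IsVirtualDiagonal N := by
  obtain ⟨U, hU1, hUx⟩ := exists_bounded_approximateUnit A
  obtain ⟨L, hL, hLt⟩ := exists_diagonal_limit U hU1
  have hstar : Continuous fun u : unitary (Unitization ℂ A) => star (u : Unitization ℂ A) :=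
    continuous_star.comp continuous_subtype_val
  -- `N` is the mean over `u` of the limits of `u e ⊗ e u*`. Right multiplication reverses products,
  -- and taking `star u` there restores a homomorphism in `u`.
  obtain ⟨N, hinv, hN⟩ := hU.exists_invariant_formFunctional
    (S := fun u => lact (u : Unitization ℂ A)) (T := fun u => ract (star u : Unitization ℂ A))
    (continuous_lact.comp continuous_subtype_val) (continuous_ract.comp hstar)
    norm_lact_le (fun u => norm_ract_le (star u)) (fun u v => lact_mul _ _)
    (fun u v x => by rw [Submonoid.coe_mul, star_mul, ract_mul]) L hL
  have hbal : ∀ (β : BilForm A) (x : Unitization ℂ A),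
      N (BilForm.pullback (lact x) (.id ℂ A) β) = N (BilForm.pullback (.id ℂ A) (ract x) β) := by
    intro β x
    -- Every element of a unital C*-algebra is a combination of four unitaries, and both sides are
    -- linear in `x`.
    obtain ⟨w, k, rfl, -⟩ := CStarAlgebra.exists_sum_four_unitary x
    rw [BilForm.pullback_sum_left _ k _ (lact_sum_smul _ k fun i => (w i : Unitization ℂ A)),
      BilForm.pullback_sum_right _ k _ (ract_sum_smul _ k fun i => (w i : Unitization ℂ A)),
      map_sum, map_sum]
    refine Finset.sum_congr rfl fun i _ => ?_
    rw [map_smul, map_smul,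
      -- For unitary `w`, invariance turns `(a, b) ↦ β a (b w)` into `(a, b) ↦ β (w a) (b w* w)`,
      -- where `w* w = 1`.
      ← hinv (w i) (BilForm.pullback (.id ℂ A) (ract (w i : Unitization ℂ A)) β)]
    congr 2
    refine BilForm.ext fun a b => ?_
    change β (lact _ a) b = β (lact _ a) (ract _ (ract _ b))
    rw [← ract_mul, Unitary.coe_star_mul_self, ract_one]
  refine ⟨N, ⟨fun β => ContinuousLinearMap.ext fun c => ?_,
    fun f => ContinuousLinearMap.ext fun c => ?_⟩⟩
  · have h := hbal β (c : Unitization ℂ A)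
    have e₁ : BilForm.pullback (lact (c : Unitization ℂ A)) (.id ℂ A) β = leftMulForm β c := by
      refine BilForm.ext fun a b => ?_
      change β (lact _ a) b = β (c * a) b
      simp [lact_apply]
    have e₂ : BilForm.pullback (.id ℂ A) (ract (c : Unitization ℂ A)) β = rightMulForm β c := by
      refine BilForm.ext fun a b => ?_
      change β a (ract _ b) = β a (b * c)
      simp [ract_apply]
    rwa [e₁, e₂] at h
  -- For each `u`, `f (u e e u* c)` tends to `f (u u* c) = f c`, by the approximate unit applied to
  -- `u* c`, which lies in `A`. The function averaged is thus constant.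
  · refine hN (productForm f c) (f c) fun u => tendsto_nhds_unique (hLt _) ?_
    have h₁ : lact (u : Unitization ℂ A) (lact (star u : Unitization ℂ A) c) = c := by
      rw [← lact_mul, ← Unitary.coe_star, Unitary.coe_mul_star_self, lact_one]
    have h₂ := ((f.comp (lact (u : Unitization ℂ A))).continuous.tendsto _).comp
      (hUx (lact (star u : Unitization ℂ A) c))
    rw [comp_apply, h₁] at h₂
    refine h₂.congr fun e => ?_
    change f (lact _ (e * (e * lact _ c))) = f (lact _ e * ract _ e * c)
    rw [mul_assoc, ract_mul_eq, lact_mul_eq]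

theorem exists_isVirtualDiagonal_of_commute_or_finiteDimensional {A : Type u}
    [NonUnitalCStarAlgebra A] (hA : (∀ a b : A, a * b = b * a) ∨ FiniteDimensional ℂ A) :
    ∃ N : StrongDual ℂ (BilForm A), IsVirtualDiagonal N := by
  refine HasInvariantMean.exists_isVirtualDiagonal ?_
  -- If `A` is commutative, so is its unitization and the unitary group is abelian. If `A` is
  -- finite-dimensional, the unitary group is closed and bounded in a proper space, hence compact.
  rcases hA with hA | hA
  · refine hasInvariantMean_of_commute fun x y => Subtype.ext ?_
    change (x : Unitization ℂ A) * y = y * x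
    ext
    · simp [mul_comm]
    · simp [hA, add_comm]
  · have : FiniteDimensional ℂ (Unitization ℂ A) :=
      Module.Finite.equiv (Unitization.linearEquiv ℂ ℂ A).symm
    have : ProperSpace (Unitization ℂ A) := FiniteDimensional.proper ℂ _
    have hc : IsCompact (unitary (Unitization ℂ A) : Set (Unitization ℂ A)) := by
      refine Metric.isCompact_of_isClosed_isBounded ?_ ?_
      · exact isClosed_unitary
      · refine isBounded_iff_forall_norm_le.2 ⟨1, fun x hx => ?_⟩
        exact CStarRing.norm_of_mem_unitary hx |>.le
    have : CompactSpace (unitary (Unitization ℂ A)) := isCompact_iff_compactSpace.1 hc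
    exact hasInvariantMean_of_compact

end

theorem corollary2p6 {G : Type u} [Group G] (hG : IsAmenableGroup G)
    {A : Type v} [NonUnitalCStarAlgebra A]
    (hA : (∀ a b : A, a * b = b * a) ∨ FiniteDimensional ℂ A)
    (α : G →* (A ≃⋆ₐ[ℂ] A)) :
    IsAmenableBanachAlgebra.{max u v, w} (CrossedProduct α) := by
  obtain ⟨N, hN⟩ := exists_isVirtualDiagonal_of_commute_or_finiteDimensional hA
  obtain ⟨M, hM⟩ := L1Algebra.exists_isVirtualDiagonal (α := α) hG hN
  obtain ⟨K, hK⟩ := CStarEnvelope.exists_isVirtualDiagonal hM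
  exact hK.isAmenableBanachAlgebra
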